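/- Let $\mathfrak{Hilb}$ be the monoidal $W^*$-category of Hilbert spaces with the Hilbert space tensor product. A \emph{Hilbert space tensor category} is a monoidal $W^*$-category $\mathcal C$ with a faithful strict monoidal functor $\mathfrak{For}\colon\mathcal C\to\mathfrak{Hilb}$, so that $\mathcal C(x_1,x_2)\subseteq\mathbb B(\mathfrak{For}(x_1),\mathfrak{For}(x_2))$ is a weakly closed subspace, and a strict monoidal functor $\tau\colon\mathfrak{Hilb}\to\mathcal C$ with $\mathfrak{For}\circ\tau=\mathrm{id}$, such that: (a) if $\mathfrak{For}(x)=\mathfrak{For}(x')$ and the identity operator belongs to $\mathcal C(x,x')$, then $x=x'$; (b) if $a\colon\mathfrak{For}(x_1)\to\mathfrak{For}(x_2)$ is a bounded operator and $a\otimes\mathrm{id}$ belongs to $\mathcal C(x_1\otimes y,x_2\otimes y)$ or $\mathrm{id}\otimes a$ belongs to $\mathcal C(y\otimes x_1,y\otimes x_2)$ for some $y$ with $\mathfrak{For}(y)\neq0$, then $a\in\mathcal C(x_1,x_2)$. Write $\mathcal H^x:=\mathfrak{For}(x)$ and $\tau(x):=\tau(\mathfrak{For}(x))$. A \emph{natural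 right absorber} in $\mathcal C$ is an object $\rho$ with unitary arrows $U^x\in\mathcal C(x\otimes\rho,\tau(x)\otimes\rho)$ for all objects $x$ of $\mathcal C$ such that $U^{x_2}(a\otimes\mathrm{id}_\rho)=(a\otimes\mathrm{id}_\rho)U^{x_1}$ for all $a\in\mathcal C(x_1,x_2)$ and $U^{x_1\otimes x_2}=U^{x_1}_{13}U^{x_2}_{23}$ for all $x_1,x_2$, in leg numbering notation. Let $(\rho,(U^x)_x)$ and $(\check\rho,(\check U^x)_x)$ be two natural right absorbers in the same Hilbert space tensor category $\mathcal C$. Let $\mathcal H:=\mathcal H^\rho$, $\check{\mathcal H}:=\mathcal H^{\check\rho}$, $U:=U^\rho\in\mathcal U(\mathcal H\otimes\mathcal H)$, $\check U:=\check U^{\check\rho}\in\mathcal U(\check{\mathcal H}\otimes\check{\mathcal H})$, $V:=U^{\check\rho}\in\mathcal U(\check{\mathcal H}\otimes\mathcal H)$, $W:=\check U^{\rho}\in\mathcal U(\mathcal H\otimes\check{\mathcal H})$. Then $U$ and $\check U$ are multiplicative unitaries, that is, $U_{23}U_{12}=U_{12}U_{13}U_{23}$ and $\check U_{23}\check U_{12}=\check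 U_{12}\check U_{13}\check U_{23}$, and \begin{alignat*}{2} U_{23}V_{12}&=V_{12}V_{13}U_{23},&\qquad \check U_{23}W_{12}&=W_{12}W_{13}\check U_{23},\\ V_{23}\check U_{12}&=\check U_{12}V_{13}V_{23},&\qquad W_{23}U_{12}&=U_{12}W_{13}W_{23},\\ V_{23}W_{12}&=W_{12}U_{13}V_{23},&\qquad W_{23}V_{12}&=V_{12}\check U_{13}W_{23}. \end{alignat*} If $U$ and $\check U$ are manageable (in the sense of Woronowicz), then $V$ is a morphism from the $C^*$-quantum group generated by $\check U$ to the one generated by $U$, $W$ is a morphism in the opposite direction, and these two morphisms are inverse to each other. Here $X\in\mathcal U(\mathcal K\otimes\mathcal K)$ is manageable if there are a positive self-adjoint operator $Q$ on $\mathcal K$ with $\ker Q=0$ and a unitary $\tilde X$ on $\overline{\mathcal K}\otimes\mathcal K$ with $X^*(Q\otimes Q)X=Q\otimes Q$ and $\langle x\otimes u, X(z\otimes y)\rangle=\langle\bar z\otimes Qu,\tilde X(\bar x\otimes Q^{-1}y)\rangle$ for all $x,z\in\mathcal K$, $u\in\operatorname{dom}Q$, $y\in\operatorname{dom}Q^{-1}$.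 A manageable multiplicative unitary $X\in\mathcal U(\mathcal K\otimes\mathcal K)$ generates the $C^*$-quantum group $(A_X,\Delta_X)$, where $A_X\subseteq\mathbb B(\mathcal K)$ is the closed linear span of $(\omega\otimes\mathrm{id})(X)$, $\omega\in\mathbb B(\mathcal K)_*$, and $\Delta_X(a)=X(a\otimes1)X^*$; its dual is $(\hat A_X,\hat\Delta_X)$, where $\hat A_X$ is the closed linear span of $(\mathrm{id}\otimes\omega)(X)$ and $\hat\Delta_X(a)=\Sigma X^*(1\otimes a)X\Sigma$ with the flip $\Sigma$. A morphism from $(A_X,\Delta_X)$ to $(A_Y,\Delta_Y)$ is a bicharacter, that is, a unitary multiplier $T$ of $\hat A_X\otimes A_Y$ with $(\hat\Delta_X\otimes\mathrm{id})(T)=T_{23}T_{13}$ and $(\mathrm{id}\otimes\Delta_Y)(T)=T_{12}T_{13}$. A bicharacter $T''$ from $X$ to $Z$ is the composition of bicharacters $T$ from $X$ to $Y$ and $T'$ from $Y$ to $Z$ if $T'_{23}T_{12}=T_{12}T''_{13}T'_{23}$; the identity morphism on $(A_X,\Delta_X)$ is $X$. -/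

import Mathlib

open scoped TensorProduct InnerProductSpace

universe u v

noncomputable section

namespace HilbertQG

/-! ### The tensor product of Hilbert spaces -/

/-- The Hilbert space tensor product: the completion of the algebraic tensor product for the inner
product determined by `⟪h ⊗ k, h' ⊗ k'⟫ = ⟪h, h'⟫ * ⟪k, k'⟫`. -/
def HTensor (H K : Type*) [NormedAddCommGroup H] [InnerProductSpace ℂ H]
    [NormedAddCommGroup K] [InnerProductSpace ℂ K] : Type _ :=
  UniformSpace.Completion (H ⊗[ℂ] K)

infixl:70 " ⊗ₕ " => HTensor

section Instances

variable (H K : Type*) [NormedAddCommGroup H] [InnerProductSpace ℂ H]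
  [NormedAddCommGroup K] [InnerProductSpace ℂ K]

instance : NormedAddCommGroup (H ⊗ₕ K) :=
  inferInstanceAs (NormedAddCommGroup (UniformSpace.Completion (H ⊗[ℂ] K)))

instance : InnerProductSpace ℂ (H ⊗ₕ K) :=
  inferInstanceAs (InnerProductSpace ℂ (UniformSpace.Completion (H ⊗[ℂ] K)))

instance : CompleteSpace (H ⊗ₕ K) :=
  inferInstanceAs (CompleteSpace (UniformSpace.Completion (H ⊗[ℂ] K)))

end Instances

section Tensor

variable {H K L H' K' E : Type*}
  [NormedAddCommGroup H] [InnerProductSpace ℂ H]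
  [NormedAddCommGroup K] [InnerProductSpace ℂ K]
  [NormedAddCommGroup L] [InnerProductSpace ℂ L]
  [NormedAddCommGroup H'] [InnerProductSpace ℂ H']
  [NormedAddCommGroup K'] [InnerProductSpace ℂ K']
  [NormedAddCommGroup E] [InnerProductSpace ℂ E]

variable (H K) in
/-- The inclusion of the algebraic tensor product. -/
def ofAlg : H ⊗[ℂ] K →ₗᵢ[ℂ] H ⊗ₕ K :=
  (UniformSpace.Completion.toComplₗᵢ : H ⊗[ℂ] K →ₗᵢ[ℂ] UniformSpace.Completion (H ⊗[ℂ] K))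

/-- The elementary tensor `h ⊗ k`. -/
def tmul (h : H) (k : K) : H ⊗ₕ K := ofAlg H K (h ⊗ₜ[ℂ] k)

lemma htensor_induction {p : H ⊗ₕ K → Prop} (hp : IsClosed {x | p x}) (h0 : p 0)
    (ht : ∀ h k, p (tmul h k)) (ha : ∀ x y, p x → p y → p (x + y)) (x : H ⊗ₕ K) : p x := by
  refine UniformSpace.Completion.induction_on (p := p) x hp (fun a => ?_)
  change p (ofAlg H K a)
  induction a using TensorProduct.induction_on with
  | zero => rwa [map_zero]
  | tmul h k => exact ht h k
  | add a b h₁ h₂ => rw [map_add]; exact ha _ _ h₁ h₂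

/-- The operator `K → H ⊗ K`, `k ↦ h ⊗ k`. -/
def ketLeft (K : Type*) [NormedAddCommGroup K] [InnerProductSpace ℂ K] (h : H) :
    K →L[ℂ] H ⊗ₕ K :=
  (ofAlg H K).toContinuousLinearMap.comp (TensorProduct.mkL ℂ H K h)

/-- The operator `H → H ⊗ K`, `h ↦ h ⊗ k`. -/
def ketRight (H : Type*) [NormedAddCommGroup H] [InnerProductSpace ℂ H] (k : K) :
    H →L[ℂ] H ⊗ₕ K :=
  (ofAlg H K).toContinuousLinearMap.comp ((TensorProduct.mkL ℂ H K).flip k)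

/-- The tensor product `f ⊗ g` of two bounded operators. -/
def tmap (f : H →L[ℂ] H') (g : K →L[ℂ] K') : H ⊗ₕ K →L[ℂ] H' ⊗ₕ K' :=
  ((TensorProduct.mapL f g).completion :
    UniformSpace.Completion (H ⊗[ℂ] K) →L[ℂ] UniformSpace.Completion (H' ⊗[ℂ] K'))

@[simp] lemma ketLeft_apply (h : H) (k : K) : ketLeft K h k = tmul h k := rfl

@[simp] lemma ketRight_apply (h : H) (k : K) : ketRight H k h = tmul h k := rfl

@[simp] lemma tmap_tmul (f : H →L[ℂ] H') (g : K →L[ℂ] K') (h : H) (k : K) :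
    tmap f g (tmul h k) = tmul (f h) (g k) :=
  ContinuousLinearMap.completion_apply_coe (TensorProduct.mapL f g) (h ⊗ₜ[ℂ] k)

@[simp] lemma inner_tmul (h h' : H) (k k' : K) :
    ⟪tmul h k, tmul h' k'⟫_ℂ = ⟪h, h'⟫_ℂ * ⟪k, k'⟫_ℂ := by
  simp [tmul]

/-- Bounded operators on `H ⊗ K` are determined by their values on elementary tensors. -/
lemma clm_ext {f g : H ⊗ₕ K →L[ℂ] E} (hfg : ∀ h k, f (tmul h k) = g (tmul h k)) : f = g := by
  ext x
  induction x using htensor_induction with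
  | hp => exact isClosed_eq f.continuous g.continuous
  | h0 => simp
  | ht h k => exact hfg h k
  | ha x y hx hy => rw [map_add, map_add, hx, hy]

/-- A bilinear map that multiplies inner products extends to an isometry on the Hilbert space tensor
product. -/
def liftIsometry [CompleteSpace E] (f : H →ₗ[ℂ] K →ₗ[ℂ] E)
    (hf : ∀ h h' k k', ⟪f h k, f h' k'⟫_ℂ = ⟪h, h'⟫_ℂ * ⟪k, k'⟫_ℂ) : H ⊗ₕ K →ₗᵢ[ℂ] E :=
  let g : H ⊗[ℂ] K →ₗᵢ[ℂ] E := (TensorProduct.lift f).isometryOfInner (fun x y => by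
    induction x using TensorProduct.induction_on with
    | zero => simp
    | add a b ha hb => simp only [map_add, inner_add_left, ha, hb]
    | tmul h k =>
      induction y using TensorProduct.induction_on with
      | zero => simp
      | add a b ha hb => simp only [map_add, inner_add_right, ha, hb]
      | tmul h' k' => simp [hf])
  let G : UniformSpace.Completion (H ⊗[ℂ] K) →L[ℂ] E := g.toContinuousLinearMap.fromCompletion
  { toLinearMap := G.toLinearMap
    norm_map' := fun x =>
      UniformSpace.Completion.induction_on (p := fun x => ‖G x‖ = ‖x‖) x
        (isClosed_eq (continuous_norm.comp G.continuous) continuous_norm)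
        (fun a => by simp [G]) }

@[simp] lemma liftIsometry_tmul [CompleteSpace E] (f : H →ₗ[ℂ] K →ₗ[ℂ] E) (hf) (h : H) (k : K) :
    liftIsometry f hf (tmul h k) = f h k :=
  ContinuousLinearMap.fromCompletion_apply_coe _ (h ⊗ₜ[ℂ] k)

/-- Two isometries that are inverse to each other, as an isometric isomorphism. -/
def isoOfInverse {E F : Type*} [NormedAddCommGroup E] [InnerProductSpace ℂ E]
    [NormedAddCommGroup F] [InnerProductSpace ℂ F] (f : E →ₗᵢ[ℂ] F) (g : F →ₗᵢ[ℂ] E)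
    (hfg : f.toContinuousLinearMap.comp g.toContinuousLinearMap = .id ℂ F)
    (hgf : g.toContinuousLinearMap.comp f.toContinuousLinearMap = .id ℂ E) : E ≃ₗᵢ[ℂ] F where
  toLinearEquiv := LinearEquiv.ofLinearMap f.toLinearMap g.toLinearMap
    (LinearMap.ext fun x => DFunLike.congr_fun hfg x)
    (LinearMap.ext fun x => DFunLike.congr_fun hgf x)
  norm_map' := f.norm_map

@[simp] lemma isoOfInverse_apply {E F : Type*} [NormedAddCommGroup E] [InnerProductSpace ℂ E]
    [NormedAddCommGroup F] [InnerProductSpace ℂ F] (f : E →ₗᵢ[ℂ] F) (g : F →ₗᵢ[ℂ] E)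
    (hfg) (hgf) (x : E) : isoOfInverse f g hfg hgf x = f x := rfl

@[simp] lemma isoOfInverse_symm_apply {E F : Type*} [NormedAddCommGroup E] [InnerProductSpace ℂ E]
    [NormedAddCommGroup F] [InnerProductSpace ℂ F] (f : E →ₗᵢ[ℂ] F) (g : F →ₗᵢ[ℂ] E)
    (hfg) (hgf) (y : F) : (isoOfInverse f g hfg hgf).symm y = g y := rfl

lemma tmul_add (h : H) (k k' : K) : tmul h (k + k') = tmul h k + tmul h k' :=
  (ketLeft K h).map_add k k'

lemma tmul_smul (c : ℂ) (h : H) (k : K) : tmul h (c • k) = c • tmul h k :=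
  (ketLeft K h).map_smul c k

lemma add_tmul (h h' : H) (k : K) : tmul (h + h') k = tmul h k + tmul h' k :=
  (ketRight H k).map_add h h'

lemma smul_tmul (c : ℂ) (h : H) (k : K) : tmul (c • h) k = c • tmul h k :=
  (ketRight H k).map_smul c h

variable (H K) in
/-- One half of the flip. -/
def commAux : H ⊗ₕ K →ₗᵢ[ℂ] K ⊗ₕ H :=
  liftIsometry (LinearMap.mk₂ ℂ (fun h k => tmul k h) (fun _ _ _ => tmul_add _ _ _)
    (fun _ _ _ => tmul_smul _ _ _) (fun _ _ _ => add_tmul _ _ _) (fun _ _ _ => smul_tmul _ _ _))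
    (fun h h' k k' => by simp [mul_comm])

variable (H K) in
/-- The flip `Σ : H ⊗ K → K ⊗ H`, `h ⊗ k ↦ k ⊗ h`. -/
def flip : H ⊗ₕ K ≃ₗᵢ[ℂ] K ⊗ₕ H :=
  isoOfInverse (commAux H K) (commAux K H)
    (clm_ext fun h k => by simp [commAux]) (clm_ext fun h k => by simp [commAux])

@[simp] lemma flip_tmul (h : H) (k : K) : flip H K (tmul h k) = tmul k h := by
  simp [flip, commAux]

/-- Two continuous functions on `H ⊗ K` that are additive agree if they do so on elementary
tensors. -/
lemma eq_of_tmul {A : Type*} [AddCommGroup A] [TopologicalSpace A] [T2Space A]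
    (f g : H ⊗ₕ K →+ A) (hf : Continuous f) (hg : Continuous g)
    (hfg : ∀ h k, f (tmul h k) = g (tmul h k)) (x : H ⊗ₕ K) : f x = g x := by
  induction x using htensor_induction with
  | hp => exact isClosed_eq hf hg
  | h0 => simp
  | ht h k => exact hfg h k
  | ha x y hx hy => rw [map_add, map_add, hx, hy]

/-- Inner products of images under two operators, computed on elementary tensors. -/
lemma inner_ext (f g : H ⊗ₕ K →L[ℂ] E) (c : ℂ)
    (hfg : ∀ h k h' k', ⟪f (tmul h k), g (tmul h' k')⟫_ℂ = ⟪tmul h k, tmul h' k'⟫_ℂ * c)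
    (x y : H ⊗ₕ K) : ⟪f x, g y⟫_ℂ = ⟪x, y⟫_ℂ * c := by
  refine eq_of_tmul
    ⟨⟨fun y => ⟪f x, g y⟫_ℂ, by simp⟩, fun a b => by simp only [map_add, inner_add_right]⟩
    ⟨⟨fun y => ⟪x, y⟫_ℂ * c, by simp⟩, fun a b => by simp only [inner_add_right, add_mul]⟩
    (Continuous.inner continuous_const g.continuous)
    ((Continuous.inner continuous_const continuous_id).mul continuous_const) (fun h' k' => ?_) y
  exact eq_of_tmul
    ⟨⟨fun x => ⟪f x, g (tmul h' k')⟫_ℂ, by simp⟩, fun a b => by simp only [map_add, inner_add_left]⟩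
    ⟨⟨fun x => ⟪x, tmul h' k'⟫_ℂ * c, by simp⟩, fun a b => by simp only [inner_add_left, add_mul]⟩
    (Continuous.inner f.continuous continuous_const)
    ((Continuous.inner continuous_id continuous_const).mul continuous_const)
    (fun h k => hfg h k h' k') x

variable (H K L) in
/-- One half of the associator. -/
def assocAux : (H ⊗ₕ K) ⊗ₕ L →ₗᵢ[ℂ] H ⊗ₕ (K ⊗ₕ L) :=
  liftIsometry (LinearMap.mk₂ ℂ (fun x l => tmap (.id ℂ H) (ketRight K l) x)
      (fun _ _ _ => map_add _ _ _) (fun _ _ _ => map_smul _ _ _)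
      (fun x l l' => DFunLike.congr_fun (f := tmap (.id ℂ H) (ketRight K (l + l')))
        (g := tmap (.id ℂ H) (ketRight K l) + tmap (.id ℂ H) (ketRight K l'))
        (clm_ext fun h k => by simp [tmul_add]) x)
      (fun c x l => DFunLike.congr_fun (f := tmap (.id ℂ H) (ketRight K (c • l)))
        (g := c • tmap (.id ℂ H) (ketRight K l)) (clm_ext fun h k => by simp [tmul_smul]) x))
    (fun x x' l l' => inner_ext (tmap (.id ℂ H) (ketRight K l)) (tmap (.id ℂ H) (ketRight K l'))
      ⟪l, l'⟫_ℂ (fun h k h' k' => by simp [mul_assoc]) x x')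

variable (H K L) in
/-- The other half of the associator. -/
def assocAuxInv : H ⊗ₕ (K ⊗ₕ L) →ₗᵢ[ℂ] (H ⊗ₕ K) ⊗ₕ L :=
  liftIsometry (LinearMap.mk₂ ℂ (fun h x => tmap (ketLeft K h) (.id ℂ L) x)
      (fun h h' x => DFunLike.congr_fun (f := tmap (ketLeft K (h + h')) (.id ℂ L))
        (g := tmap (ketLeft K h) (.id ℂ L) + tmap (ketLeft K h') (.id ℂ L))
        (clm_ext fun h k => by simp [add_tmul]) x)
      (fun c h x => DFunLike.congr_fun (f := tmap (ketLeft K (c • h)) (.id ℂ L))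
        (g := c • tmap (ketLeft K h) (.id ℂ L)) (clm_ext fun h k => by simp [smul_tmul]) x)
      (fun _ _ _ => map_add _ _ _) (fun _ _ _ => map_smul _ _ _))
    (fun h h' x x' => (inner_ext (tmap (ketLeft K h) (.id ℂ L)) (tmap (ketLeft K h') (.id ℂ L))
      ⟪h, h'⟫_ℂ (fun k l k' l' => by simp; ring) x x').trans (mul_comm _ _))

@[simp] lemma assocAux_tmul (h : H) (k : K) (l : L) :
    assocAux H K L (tmul (tmul h k) l) = tmul h (tmul k l) :=
  (liftIsometry_tmul _ _ _ _).trans (by simp)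

@[simp] lemma assocAuxInv_tmul (h : H) (k : K) (l : L) :
    assocAuxInv H K L (tmul h (tmul k l)) = tmul (tmul h k) l :=
  (liftIsometry_tmul _ _ _ _).trans (by simp)

/-- Bounded operators on `(H ⊗ K) ⊗ L` are determined by their values on elementary tensors. -/
lemma clm_ext₃ {f g : (H ⊗ₕ K) ⊗ₕ L →L[ℂ] E}
    (hfg : ∀ h k l, f (tmul (tmul h k) l) = g (tmul (tmul h k) l)) : f = g :=
  clm_ext fun x l => DFunLike.congr_fun (f := f.comp (ketRight _ l)) (g := g.comp (ketRight _ l))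
    (clm_ext fun h k => hfg h k l) x

/-- Bounded operators on `H ⊗ (K ⊗ L)` are determined by their values on elementary tensors. -/
lemma clm_ext₃' {f g : H ⊗ₕ (K ⊗ₕ L) →L[ℂ] E}
    (hfg : ∀ h k l, f (tmul h (tmul k l)) = g (tmul h (tmul k l))) : f = g :=
  clm_ext fun h x => DFunLike.congr_fun (f := f.comp (ketLeft _ h)) (g := g.comp (ketLeft _ h))
    (clm_ext fun k l => hfg h k l) x

variable (H K L) in
/-- The associator `(H ⊗ K) ⊗ L ≅ H ⊗ (K ⊗ L)`. -/
def assoc : (H ⊗ₕ K) ⊗ₕ L ≃ₗᵢ[ℂ] H ⊗ₕ (K ⊗ₕ L) :=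
  isoOfInverse (assocAux H K L) (assocAuxInv H K L)
    (clm_ext₃' fun h k l => by simp) (clm_ext₃ fun h k l => by simp)

@[simp] lemma assoc_tmul (h : H) (k : K) (l : L) :
    assoc H K L (tmul (tmul h k) l) = tmul h (tmul k l) := by
  simp [assoc]

@[simp] lemma assoc_symm_tmul (h : H) (k : K) (l : L) :
    (assoc H K L).symm (tmul h (tmul k l)) = tmul (tmul h k) l := by
  simp [assoc]

end Tensor

/-! ### The tensor unit -/

/-- The tensor unit: the one-dimensional Hilbert space of complex numbers, in any universe. -/
abbrev CUnit : Type u := ULift.{u} ℂ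

instance : InnerProductSpace ℂ CUnit.{u} where
  inner x y := ⟪x.down, y.down⟫_ℂ
  norm_sq_eq_re_inner x := norm_sq_eq_re_inner (𝕜 := ℂ) x.down
  conj_inner_symm x y := inner_conj_symm x.down y.down
  add_left x y z := inner_add_left x.down y.down z.down
  smul_left x y c := inner_smul_left x.down y.down c

section Unitors

variable (H : Type*) [NormedAddCommGroup H] [InnerProductSpace ℂ H] [CompleteSpace H]

/-- The map `ℂ ⊗ H → H`, `c ⊗ h ↦ c h`. -/
def leftUnitor : CUnit.{u} ⊗ₕ H →ₗᵢ[ℂ] H :=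
  liftIsometry (LinearMap.mk₂ ℂ (fun c h => c.down • h) (fun _ _ _ => add_smul _ _ _)
    (fun _ _ _ => mul_smul _ _ _) (fun _ _ _ => smul_add _ _ _) (fun _ _ _ => smul_comm _ _ _))
    (fun c c' h h' => by
      change ⟪c.down • h, c'.down • h'⟫_ℂ = ⟪c.down, c'.down⟫_ℂ * _
      rw [inner_smul_left, inner_smul_right]; simp; ring)

/-- The map `H ⊗ ℂ → H`, `h ⊗ c ↦ c h`. -/
def rightUnitor : H ⊗ₕ CUnit.{u} →ₗᵢ[ℂ] H :=
  (leftUnitor.{u} H).comp (flip H CUnit.{u}).toLinearIsometry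

end Unitors
/-! ### Leg numbering -/

section Legs

variable {H K L : Type*}
  [NormedAddCommGroup H] [InnerProductSpace ℂ H]
  [NormedAddCommGroup K] [InnerProductSpace ℂ K]
  [NormedAddCommGroup L] [InnerProductSpace ℂ L]

variable (L) in
/-- `T₁₂ = T ⊗ id` on `H ⊗ K ⊗ L`. -/
def leg12 (T : H ⊗ₕ K →L[ℂ] H ⊗ₕ K) : (H ⊗ₕ K) ⊗ₕ L →L[ℂ] (H ⊗ₕ K) ⊗ₕ L :=
  tmap T (.id ℂ L)

variable (H) in
/-- `T₂₃ = id ⊗ T` on `H ⊗ K ⊗ L`. -/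
def leg23 (T : K ⊗ₕ L →L[ℂ] K ⊗ₕ L) : (H ⊗ₕ K) ⊗ₕ L →L[ℂ] (H ⊗ₕ K) ⊗ₕ L :=
  ((assoc H K L).symm : H ⊗ₕ (K ⊗ₕ L) →L[ℂ] (H ⊗ₕ K) ⊗ₕ L) ∘L tmap (.id ℂ H) T ∘L
    (assoc H K L : (H ⊗ₕ K) ⊗ₕ L →L[ℂ] H ⊗ₕ (K ⊗ₕ L))

variable (H K L) in
/-- `Σ₂₃ : H ⊗ K ⊗ L → H ⊗ L ⊗ K`. -/
def flip23 : (H ⊗ₕ K) ⊗ₕ L →L[ℂ] (H ⊗ₕ L) ⊗ₕ K :=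
  ((assoc H L K).symm : H ⊗ₕ (L ⊗ₕ K) →L[ℂ] (H ⊗ₕ L) ⊗ₕ K) ∘L
    tmap (.id ℂ H) (flip K L : K ⊗ₕ L →L[ℂ] L ⊗ₕ K) ∘L
    (assoc H K L : (H ⊗ₕ K) ⊗ₕ L →L[ℂ] H ⊗ₕ (K ⊗ₕ L))

variable (K) in
/-- `T₁₃ = Σ₂₃ T₁₂ Σ₂₃` on `H ⊗ K ⊗ L`. -/
def leg13 (T : H ⊗ₕ L →L[ℂ] H ⊗ₕ L) : (H ⊗ₕ K) ⊗ₕ L →L[ℂ] (H ⊗ₕ K) ⊗ₕ L :=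
  flip23 H L K ∘L leg12 K T ∘L flip23 H K L

end Legs

/-! ### Hilbert space tensor categories and natural right absorbers -/

/-- A Hilbert space tensor category `𝒞`, with its faithful strict monoidal forgetful functor
`For : 𝒞 → Hilb` and the strict monoidal functor `τ : Hilb → 𝒞`, `For ∘ τ = id`.

The objects are presented by the fibres of `For` on objects: `Obj H` is the collection of the
objects `x` of `𝒞` with `For x = H` ("Hilbert spaces with extra structure"). As `For` is faithful,
arrows are bounded operators between the underlying Hilbert spaces, and all equations between
arrows are equations between operators. -/
structure HilbertTensorCategory where
  /-- The objects `x` with `For x = H`. -/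
  Obj : ∀ (H : Type u) [NormedAddCommGroup H] [InnerProductSpace ℂ H] [CompleteSpace H], Type v
  /-- The operators that come from `𝒞`. -/
  Hom : ∀ {H K : Type u} [NormedAddCommGroup H] [InnerProductSpace ℂ H] [CompleteSpace H]
    [NormedAddCommGroup K] [InnerProductSpace ℂ K] [CompleteSpace K],
    Obj H → Obj K → Submodule ℂ (H →L[ℂ] K)
  id_mem : ∀ {H : Type u} [NormedAddCommGroup H] [InnerProductSpace ℂ H] [CompleteSpace H]
    (x : Obj H), ContinuousLinearMap.id ℂ H ∈ Hom x x
  comp_mem : ∀ {H K L : Type u} [NormedAddCommGroup H] [InnerProductSpace ℂ H] [CompleteSpace H]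
    [NormedAddCommGroup K] [InnerProductSpace ℂ K] [CompleteSpace K]
    [NormedAddCommGroup L] [InnerProductSpace ℂ L] [CompleteSpace L]
    {x : Obj H} {y : Obj K} {z : Obj L} {b : K →L[ℂ] L} {a : H →L[ℂ] K},
    b ∈ Hom y z → a ∈ Hom x y → b ∘L a ∈ Hom x z
  adjoint_mem : ∀ {H K : Type u} [NormedAddCommGroup H] [InnerProductSpace ℂ H] [CompleteSpace H]
    [NormedAddCommGroup K] [InnerProductSpace ℂ K] [CompleteSpace K]
    {x : Obj H} {y : Obj K} {a : H →L[ℂ] K}, a ∈ Hom x y → a.adjoint ∈ Hom y x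
  /-- `𝒞` is a `W*`-category: its spaces of arrows are weakly closed. -/
  isClosed_hom : ∀ {H K : Type u} [NormedAddCommGroup H] [InnerProductSpace ℂ H] [CompleteSpace H]
    [NormedAddCommGroup K] [InnerProductSpace ℂ K] [CompleteSpace K] (x : Obj H) (y : Obj K),
    IsClosed {T : H →WOT[ℂ] K | T.toCLM ∈ Hom x y}
  /-- The tensor product of objects, with `For (x ⊗ y) = For x ⊗ For y`. -/
  tensor : ∀ {H K : Type u} [NormedAddCommGroup H] [InnerProductSpace ℂ H] [CompleteSpace H]
    [NormedAddCommGroup K] [InnerProductSpace ℂ K] [CompleteSpace K],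
    Obj H → Obj K → Obj (H ⊗ₕ K)
  tmap_mem : ∀ {H K H' K' : Type u}
    [NormedAddCommGroup H] [InnerProductSpace ℂ H] [CompleteSpace H]
    [NormedAddCommGroup K] [InnerProductSpace ℂ K] [CompleteSpace K]
    [NormedAddCommGroup H'] [InnerProductSpace ℂ H'] [CompleteSpace H']
    [NormedAddCommGroup K'] [InnerProductSpace ℂ K'] [CompleteSpace K']
    {x : Obj H} {y : Obj K} {x' : Obj H'} {y' : Obj K'} {a : H →L[ℂ] H'} {b : K →L[ℂ] K'},
    a ∈ Hom x x' → b ∈ Hom y y' → tmap a b ∈ Hom (tensor x y) (tensor x' y')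
  /-- The trivial object `τ H`. -/
  triv : ∀ (H : Type u) [NormedAddCommGroup H] [InnerProductSpace ℂ H] [CompleteSpace H], Obj H
  triv_hom : ∀ {H K : Type u} [NormedAddCommGroup H] [InnerProductSpace ℂ H] [CompleteSpace H]
    [NormedAddCommGroup K] [InnerProductSpace ℂ K] [CompleteSpace K] (a : H →L[ℂ] K),
    a ∈ Hom (triv H) (triv K)
  triv_tensor : ∀ (H K : Type u) [NormedAddCommGroup H] [InnerProductSpace ℂ H] [CompleteSpace H]
    [NormedAddCommGroup K] [InnerProductSpace ℂ K] [CompleteSpace K],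
    triv (H ⊗ₕ K) = tensor (triv H) (triv K)
  /-- The associator of `𝒞` is that of `Hilb`. (Its inverse, being its adjoint, is an arrow too.) -/
  assoc_mem : ∀ {H K L : Type u} [NormedAddCommGroup H] [InnerProductSpace ℂ H] [CompleteSpace H]
    [NormedAddCommGroup K] [InnerProductSpace ℂ K] [CompleteSpace K]
    [NormedAddCommGroup L] [InnerProductSpace ℂ L] [CompleteSpace L]
    (x : Obj H) (y : Obj K) (z : Obj L),
    (assoc H K L : (H ⊗ₕ K) ⊗ₕ L →L[ℂ] H ⊗ₕ (K ⊗ₕ L)) ∈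
      Hom (tensor (tensor x y) z) (tensor x (tensor y z))
  /-- The tensor unit is `τ ℂ`, with the unit transformations of `Hilb`. -/
  leftUnitor_mem : ∀ {H : Type u} [NormedAddCommGroup H] [InnerProductSpace ℂ H] [CompleteSpace H]
    (x : Obj H),
    (leftUnitor.{u} H).toContinuousLinearMap ∈ Hom (tensor (triv CUnit.{u}) x) x
  rightUnitor_mem : ∀ {H : Type u} [NormedAddCommGroup H] [InnerProductSpace ℂ H] [CompleteSpace H]
    (x : Obj H),
    (rightUnitor.{u} H).toContinuousLinearMap ∈ Hom (tensor x (triv CUnit.{u})) x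
  /-- Objects joined by the identity operator are equal. -/
  eq_of_id_mem : ∀ {H : Type u} [NormedAddCommGroup H] [InnerProductSpace ℂ H] [CompleteSpace H]
    {x x' : Obj H}, ContinuousLinearMap.id ℂ H ∈ Hom x x' → x = x'
  /-- Cancellation on the right. The object `y` has to be nonzero, because `a ⊗ id` is always an
  arrow if `y` lives on the zero Hilbert space. -/
  cancel_right : ∀ {H K L : Type u} [NormedAddCommGroup H] [InnerProductSpace ℂ H] [CompleteSpace H]
    [NormedAddCommGroup K] [InnerProductSpace ℂ K] [CompleteSpace K]
    [NormedAddCommGroup L] [InnerProductSpace ℂ L] [CompleteSpace L] [Nontrivial L]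
    {x : Obj H} {x' : Obj K} (y : Obj L) {a : H →L[ℂ] K},
    tmap a (.id ℂ L) ∈ Hom (tensor x y) (tensor x' y) → a ∈ Hom x x'
  /-- Cancellation on the left. -/
  cancel_left : ∀ {H K L : Type u} [NormedAddCommGroup H] [InnerProductSpace ℂ H] [CompleteSpace H]
    [NormedAddCommGroup K] [InnerProductSpace ℂ K] [CompleteSpace K]
    [NormedAddCommGroup L] [InnerProductSpace ℂ L] [CompleteSpace L] [Nontrivial L]
    {x : Obj H} {x' : Obj K} (y : Obj L) {a : H →L[ℂ] K},
    tmap (.id ℂ L) a ∈ Hom (tensor y x) (tensor y x') → a ∈ Hom x x'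

/-- The structure of a natural right absorber on an object `ρ` of `𝒞`: natural unitary arrows
`Uˣ : x ⊗ ρ → τ(x) ⊗ ρ`, compatible with tensor products. -/
structure NaturalRightAbsorber (C : HilbertTensorCategory.{u, v}) {H : Type u}
    [NormedAddCommGroup H] [InnerProductSpace ℂ H] [CompleteSpace H] (ρ : C.Obj H) where
  /-- The unitaries `Uˣ`. -/
  U : ∀ {K : Type u} [NormedAddCommGroup K] [InnerProductSpace ℂ K] [CompleteSpace K]
    (_x : C.Obj K), K ⊗ₕ H →L[ℂ] K ⊗ₕ H
  unitary_mem : ∀ {K : Type u} [NormedAddCommGroup K] [InnerProductSpace ℂ K] [CompleteSpace K]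
    (x : C.Obj K), U x ∈ unitary (K ⊗ₕ H →L[ℂ] K ⊗ₕ H)
  hom_mem : ∀ {K : Type u} [NormedAddCommGroup K] [InnerProductSpace ℂ K] [CompleteSpace K]
    (x : C.Obj K), U x ∈ C.Hom (C.tensor x ρ) (C.tensor (C.triv K) ρ)
  natural : ∀ {K L : Type u} [NormedAddCommGroup K] [InnerProductSpace ℂ K] [CompleteSpace K]
    [NormedAddCommGroup L] [InnerProductSpace ℂ L] [CompleteSpace L]
    {x : C.Obj K} {y : C.Obj L} {a : K →L[ℂ] L}, a ∈ C.Hom x y →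
    U y ∘L tmap a (.id ℂ H) = tmap a (.id ℂ H) ∘L U x
  tensor_eq : ∀ {K L : Type u} [NormedAddCommGroup K] [InnerProductSpace ℂ K] [CompleteSpace K]
    [NormedAddCommGroup L] [InnerProductSpace ℂ L] [CompleteSpace L]
    (x : C.Obj K) (y : C.Obj L),
    U (C.tensor x y) = leg13 L (U x) ∘L leg23 K (U y)

/-! ### Multiplicative unitaries and manageability -/

/-- The complex conjugate `H̄` of a Hilbert space `H`: the same additive group, with scalar
multiplication `c • x̄ = (c̄ • x)‾` and inner product `⟪x̄, ȳ⟫ = ⟪y, x⟫`. -/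
def ConjSpace (H : Type*) : Type _ := H

/-- The conjugate-linear identification `x ↦ x̄`. -/
def toConj {H : Type*} (x : H) : ConjSpace H := x

/-- The inverse of `x ↦ x̄`. -/
def ofConj {H : Type*} (x : ConjSpace H) : H := x

section Manageable

variable {H : Type*} [NormedAddCommGroup H] [InnerProductSpace ℂ H]

instance : NormedAddCommGroup (ConjSpace H) := inferInstanceAs (NormedAddCommGroup H)

instance : InnerProductSpace ℂ (ConjSpace H) where
  smul c x := toConj (starRingEnd ℂ c • ofConj x)
  one_smul x := show starRingEnd ℂ 1 • ofConj x = ofConj x by simp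
  mul_smul a b x := show starRingEnd ℂ (a * b) • ofConj x =
    starRingEnd ℂ a • starRingEnd ℂ b • ofConj x by simp [mul_smul]
  smul_zero a := show starRingEnd ℂ a • (0 : H) = 0 from smul_zero _
  smul_add a x y := show starRingEnd ℂ a • (ofConj x + ofConj y) = _ from smul_add _ _ _
  add_smul a b x := show starRingEnd ℂ (a + b) • ofConj x =
    starRingEnd ℂ a • ofConj x + starRingEnd ℂ b • ofConj x by simp [add_smul]
  zero_smul x := show starRingEnd ℂ 0 • ofConj x = (0 : H) by simp
  norm_smul_le a x := show ‖starRingEnd ℂ a • ofConj x‖ ≤ ‖a‖ * ‖ofConj x‖ by simp [norm_smul]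
  inner x y := ⟪ofConj y, ofConj x⟫_ℂ
  norm_sq_eq_re_inner x := norm_sq_eq_re_inner (𝕜 := ℂ) (ofConj x)
  conj_inner_symm x y := inner_conj_symm (ofConj y) (ofConj x)
  add_left x y z := inner_add_right (ofConj z) (ofConj x) (ofConj y)
  smul_left x y c := inner_smul_right (ofConj y) (ofConj x) (starRingEnd ℂ c)

/-- A multiplicative unitary: a unitary with the pentagon equation `W₂₃ W₁₂ = W₁₂ W₁₃ W₂₃`. -/
structure IsMultiplicativeUnitary (W : H ⊗ₕ H →L[ℂ] H ⊗ₕ H) : Prop where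
  unitary_mem : W ∈ unitary (H ⊗ₕ H →L[ℂ] H ⊗ₕ H)
  pentagon : leg23 H W * leg12 H W = leg12 H W * leg13 H W * leg23 H W

/-- The graph of `Q ⊗ Q`, the closure of the operator `u ⊗ v ↦ Q u ⊗ Q v` on the algebraic tensor
product of the domains. -/
def tensorSquareGraph (Q : H →ₗ.[ℂ] H) : Submodule ℂ ((H ⊗ₕ H) × (H ⊗ₕ H)) :=
  (Submodule.span ℂ (Set.range fun p : Q.domain × Q.domain =>
    (tmul (p.1 : H) (p.2 : H), tmul (Q p.1) (Q p.2)))).topologicalClosure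

/-- Manageability of a multiplicative unitary `W` on `H ⊗ H` (Woronowicz): there are a positive
self-adjoint operator `Q` on `H` with trivial kernel and a unitary `W̃` on `H̄ ⊗ H` with
`W* (Q ⊗ Q) W = Q ⊗ Q` and `⟪x ⊗ u, W (z ⊗ y)⟫ = ⟪z̄ ⊗ Q u, W̃ (x̄ ⊗ Q⁻¹ y)⟫` for all `x, z ∈ H`,
`u ∈ dom Q`, `y ∈ dom Q⁻¹`; the elements of `dom Q⁻¹` are written as `y = Q v` with
`v ∈ dom Q`. -/
def IsManageable [CompleteSpace H] (W : H ⊗ₕ H →L[ℂ] H ⊗ₕ H) : Prop :=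
  ∃ (Q : H →ₗ.[ℂ] H) (W' : ConjSpace H ⊗ₕ H →L[ℂ] ConjSpace H ⊗ₕ H),
    IsSelfAdjoint Q ∧ (∀ u : Q.domain, 0 ≤ (⟪(u : H), Q u⟫_ℂ).re) ∧
    (∀ u : Q.domain, Q u = 0 → u = 0) ∧
    W' ∈ unitary (ConjSpace H ⊗ₕ H →L[ℂ] ConjSpace H ⊗ₕ H) ∧
    (∀ ξ η : H ⊗ₕ H, (W ξ, W η) ∈ tensorSquareGraph Q ↔ (ξ, η) ∈ tensorSquareGraph Q) ∧
    ∀ (x z : H) (u v : Q.domain),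
      ⟪tmul x (u : H), W (tmul z (Q v))⟫_ℂ =
        ⟪tmul (toConj z) (Q u), W' (tmul (toConj x) (v : H))⟫_ℂ

end Manageable

/-! ### The quantum groups of manageable multiplicative unitaries and their morphisms -/

section QuantumGroup

variable {H K : Type*} [NormedAddCommGroup H] [InnerProductSpace ℂ H] [CompleteSpace H]
  [NormedAddCommGroup K] [InnerProductSpace ℂ K] [CompleteSpace K]

/-- The underlying `C*`-algebra `A ⊆ 𝔹(H)` of the quantum group `(A, Δ)` generated by `W`: the
norm-closed linear span of the slices `(ω ⊗ id) W` for normal functionals `ω` on `𝔹(H)`. It suffices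
to use the vector functionals `ω = ⟪x, · z⟫`, whose closed linear span is `𝔹(H)_*`; their slices
are the operators `(⟨x| ⊗ 1) W (|z⟩ ⊗ 1)`. -/
def quantumAlgebra (W : H ⊗ₕ H →L[ℂ] H ⊗ₕ H) : Submodule ℂ (H →L[ℂ] H) :=
  (Submodule.span ℂ (Set.range fun p : H × H =>
    (ketLeft H p.1).adjoint ∘L W ∘L ketLeft H p.2)).topologicalClosure

/-- The underlying `C*`-algebra `Â ⊆ 𝔹(H)` of the dual quantum group `(Â, Δ̂)`: the norm-closed
linear span of the slices `(id ⊗ ω) W`. -/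
def dualQuantumAlgebra (W : H ⊗ₕ H →L[ℂ] H ⊗ₕ H) : Submodule ℂ (H →L[ℂ] H) :=
  (Submodule.span ℂ (Set.range fun p : H × H =>
    (ketRight H p.1).adjoint ∘L W ∘L ketRight H p.2)).topologicalClosure

/-- The spatial tensor product `A ⊗ B ⊆ 𝔹(H ⊗ K)` of `A ⊆ 𝔹(H)` and `B ⊆ 𝔹(K)`. -/
def spatialTensor (A : Submodule ℂ (H →L[ℂ] H)) (B : Submodule ℂ (K →L[ℂ] K)) :
    Submodule ℂ (H ⊗ₕ K →L[ℂ] H ⊗ₕ K) :=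
  (Submodule.span ℂ (Set.range fun p : A × B =>
    tmap (p.1 : H →L[ℂ] H) (p.2 : K →L[ℂ] K))).topologicalClosure

/-- The multiplier algebra of a nondegenerate `C*`-algebra `A ⊆ 𝔹(H)`, as its idealiser. -/
def multipliers (A : Submodule ℂ (H →L[ℂ] H)) : Set (H →L[ℂ] H) :=
  {T | ∀ S ∈ A, T * S ∈ A ∧ S * T ∈ A}

/-- The comultiplication `Δ(a) = W (a ⊗ 1) W*` of the quantum group generated by `W`, applied to
the second leg: the strictly continuous extension of `b ⊗ a ↦ b ⊗ Δ(a)` to multipliers on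
`K ⊗ H` is `V ↦ W₂₃ V₁₂ W₂₃*`. -/
def comulSnd (W : H ⊗ₕ H →L[ℂ] H ⊗ₕ H) (V : K ⊗ₕ H →L[ℂ] K ⊗ₕ H) :
    (K ⊗ₕ H) ⊗ₕ H →L[ℂ] (K ⊗ₕ H) ⊗ₕ H :=
  leg23 K W * leg12 H V * (leg23 K W).adjoint

/-- The comultiplication `Δ̂(a) = Σ W* (1 ⊗ a) W Σ` of the dual quantum group, applied to the first
leg: the strictly continuous extension of `a ⊗ b ↦ Δ̂(a) ⊗ b` to multipliers on `H ⊗ K` is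
`V ↦ Σ₁₂ W₁₂* V₂₃ W₁₂ Σ₁₂`. -/
def dualComulFst (W : H ⊗ₕ H →L[ℂ] H ⊗ₕ H) (V : H ⊗ₕ K →L[ℂ] H ⊗ₕ K) :
    (H ⊗ₕ H) ⊗ₕ K →L[ℂ] (H ⊗ₕ H) ⊗ₕ K :=
  leg12 K (flip H H : H ⊗ₕ H →L[ℂ] H ⊗ₕ H) *
    ((leg12 K W).adjoint * leg23 H V * leg12 K W) *
    leg12 K (flip H H : H ⊗ₕ H →L[ℂ] H ⊗ₕ H)

/-- Morphisms of `C*`-quantum groups from `(C, Δ_C)`, generated by `X` on `H ⊗ H`, to `(A, Δ_A)`,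
generated by `Y` on `K ⊗ K`: bicharacters, that is, unitary multipliers `V` of `Ĉ ⊗ A` with
`(Δ̂_C ⊗ id) V = V₂₃ V₁₃` and `(id ⊗ Δ_A) V = V₁₂ V₁₃`. -/
structure IsBicharacter (X : H ⊗ₕ H →L[ℂ] H ⊗ₕ H) (Y : K ⊗ₕ K →L[ℂ] K ⊗ₕ K)
    (V : H ⊗ₕ K →L[ℂ] H ⊗ₕ K) : Prop where
  unitary_mem : V ∈ unitary (H ⊗ₕ K →L[ℂ] H ⊗ₕ K)
  mem_multipliers : V ∈ multipliers (spatialTensor (dualQuantumAlgebra X) (quantumAlgebra Y))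
  dualComul_eq : dualComulFst X V = leg23 H V * leg13 H V
  comul_eq : comulSnd Y V = leg12 K V * leg13 K V

/-- The bicharacter `V''` from `X` to `Z` is the composition of the bicharacters `V` from `X` to `Y`
and `V'` from `Y` to `Z`: this means `V'₂₃ V₁₂ = V₁₂ V''₁₃ V'₂₃`. -/
structure IsComposition {L : Type*} [NormedAddCommGroup L] [InnerProductSpace ℂ L] [CompleteSpace L]
    (X : H ⊗ₕ H →L[ℂ] H ⊗ₕ H) (Y : K ⊗ₕ K →L[ℂ] K ⊗ₕ K) (Z : L ⊗ₕ L →L[ℂ] L ⊗ₕ L)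
    (V : H ⊗ₕ K →L[ℂ] H ⊗ₕ K) (V' : K ⊗ₕ L →L[ℂ] K ⊗ₕ L) (V'' : H ⊗ₕ L →L[ℂ] H ⊗ₕ L) :
    Prop where
  fst : IsBicharacter X Y V
  snd : IsBicharacter Y Z V'
  comp : IsBicharacter X Z V''
  eq : leg23 H V' * leg12 L V = leg12 L V * leg13 K V'' * leg23 H V'

/-- `V` and `W` are morphisms from `X` to `Y` and from `Y` to `X` that are inverse to each other:
their compositions are the identity morphisms, which are the multiplicative unitaries `X` and
`Y` themselves, viewed as bicharacters. -/
structure AreInverseMorphisms (X : H ⊗ₕ H →L[ℂ] H ⊗ₕ H) (Y : K ⊗ₕ K →L[ℂ] K ⊗ₕ K)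
    (V : H ⊗ₕ K →L[ℂ] H ⊗ₕ K) (W : K ⊗ₕ H →L[ℂ] K ⊗ₕ H) : Prop where
  comp_fst : IsComposition X Y X V W X
  comp_snd : IsComposition Y X Y W V Y

end QuantumGroup

end HilbertQG

end

open HilbertQG

/-
Write `U'^x : x ⊗ ρ' → τ(x) ⊗ ρ'` for the arrows of the second absorber. Naturality of `U` at the
arrow `U'^x` and the tensor rule give `U^ρ'₂₃ U'^x₁₂ = U'^x₁₂ U^x₁₃ U^ρ'₂₃`, because `U` is trivial
on the objects in the image of `τ`: for `u = U^τ(ℂ)` the tensor rule reads `u² = u`, and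
naturality along the maps `ℂ → K` transports `u = 1` to all of them. The choices of the two
absorbers and of `x` among `ρ`, `ρ'` give all eight relations.

Let `X` on `K ⊗ K` and `W` on `H ⊗ H` generate `Â` and `A`. That `V` multiplies `Â ⊗ A` is shown
with closed linear spans. Call a Hilbert module `M` of operators stable under a unitary `T` if
`T M = M`. If `W` is manageable with `W̃` and `Q`, the pentagon equation and the relation between
`W` and `W̃` turn the generators of `W (H ⊗ A)` into those of `H ⊗ A`, so `W` stabilises `H ⊗ A`;
this already makes `A` a `C*`-algebra. Via `W₂₃ V₁₂ = V₁₂ V₁₃ W₂₃` the stability passes to `V` and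
`K ⊗ A`. The same argument for the dual `Σ X* Σ` shows that `X₁₂` stabilises `Â ⊗ K ⊗ A`, and
`V₁₃ V₂₃ = X₁₂* V₂₃ X₁₂` implies that `V₁₃` does so as well. Slicing the middle leg, `V` stabilises
`Â ⊗ A`.
-/

noncomputable section

namespace HilbertQG

open ContinuousLinearMap

section ClosedSpan

variable {ι E F : Type*} [NormedAddCommGroup E] [NormedSpace ℂ E]
  [NormedAddCommGroup F] [NormedSpace ℂ F]

/-- The closed linear span of a family of vectors. -/
abbrev closedSpan (g : ι → E) : Submodule ℂ E :=
  (Submodule.span ℂ (Set.range g)).topologicalClosure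

lemma isClosed_closedSpan (g : ι → E) : IsClosed (closedSpan g : Set E) :=
  Submodule.isClosed_topologicalClosure _

lemma mem_closedSpan (g : ι → E) (i : ι) : g i ∈ closedSpan g :=
  Submodule.le_topologicalClosure _ (Submodule.subset_span ⟨i, rfl⟩)

lemma forall_mem_closedSpan_iff {σ : ℂ →+* ℂ} {g : ι → E} (f : E →SL[σ] F) {N : Submodule ℂ F}
    (hN : IsClosed (N : Set F)) : (∀ x ∈ closedSpan g, f x ∈ N) ↔ ∀ i, f (g i) ∈ N := by
  refine ⟨fun h i => h _ (mem_closedSpan g i), fun h => ?_⟩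
  have : closedSpan g ≤ N.comap f.toLinearMap :=
    Submodule.topologicalClosure_minimal _
      (Submodule.span_le.2 (Set.range_subset_iff.2 h)) (hN.preimage f.continuous)
  exact this

lemma closedSpan_le_iff {g : ι → E} {N : Submodule ℂ E} (hN : IsClosed (N : Set E)) :
    closedSpan g ≤ N ↔ ∀ i, g i ∈ N :=
  forall_mem_closedSpan_iff (.id ℂ E) hN

lemma forall_mem_iff_of_denseRange {X : Type*} [TopologicalSpace X] {d : ι → X} (hd : DenseRange d)
    {f : X → F} (hf : Continuous f) {N : Submodule ℂ F} (hN : IsClosed (N : Set F)) :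
    (∀ x, f x ∈ N) ↔ ∀ i, f (d i) ∈ N :=
  ⟨fun h i => h (d i), fun h x => hd.induction_on x (hN.preimage hf) h⟩

end ClosedSpan

section Calculus

variable {H K L H' K' H'' K'' E : Type*}
  [NormedAddCommGroup H] [InnerProductSpace ℂ H]
  [NormedAddCommGroup K] [InnerProductSpace ℂ K]
  [NormedAddCommGroup L] [InnerProductSpace ℂ L]
  [NormedAddCommGroup H'] [InnerProductSpace ℂ H']
  [NormedAddCommGroup K'] [InnerProductSpace ℂ K']
  [NormedAddCommGroup H''] [InnerProductSpace ℂ H'']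
  [NormedAddCommGroup K''] [InnerProductSpace ℂ K'']

lemma forall_htensor_mem_iff [NormedAddCommGroup E] [NormedSpace ℂ E] {σ : ℂ →+* ℂ}
    (f : H ⊗ₕ K →SL[σ] E) {N : Submodule ℂ E} (hN : IsClosed (N : Set E)) :
    (∀ ζ, f ζ ∈ N) ↔ ∀ h k, f (tmul h k) ∈ N := by
  refine ⟨fun hf h k => hf _, fun hf ζ => ?_⟩
  induction ζ using htensor_induction with
  | hp => exact hN.preimage f.continuous
  | h0 => simp
  | ht h k => exact hf h k
  | ha x y hx hy => rw [map_add]; exact N.add_mem hx hy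

lemma forall_htensor_mem_iff_of_denseRange {ι κ : Type*} {d : ι → H} {d' : κ → K}
    (hd : DenseRange d) (hd' : DenseRange d') [NormedAddCommGroup E] [NormedSpace ℂ E]
    {σ : ℂ →+* ℂ} (f : H ⊗ₕ K →SL[σ] E) {N : Submodule ℂ E} (hN : IsClosed (N : Set E)) :
    (∀ ζ, f ζ ∈ N) ↔ ∀ i j, f (tmul (d i) (d' j)) ∈ N := by
  rw [forall_htensor_mem_iff f hN, forall_comm, forall_comm (α := ι)]
  trans ∀ k i, f (tmul (d i) k) ∈ N
  · exact forall_congr' fun k => forall_mem_iff_of_denseRange (f := fun h => f (tmul h k)) hd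
      (f.continuous.comp (ketRight H k).continuous) hN
  · rw [forall_comm, forall_comm (α := κ)]
    exact forall_congr' fun i => forall_mem_iff_of_denseRange (f := fun k => f (tmul (d i) k)) hd'
      (f.continuous.comp (ketLeft K (d i)).continuous) hN

lemma tmap_comp (f : H' →L[ℂ] H'') (g : K' →L[ℂ] K'') (f' : H →L[ℂ] H') (g' : K →L[ℂ] K') :
    tmap f g ∘L tmap f' g' = tmap (f ∘L f') (g ∘L g') :=
  clm_ext fun h k => by simp

lemma tmap_apply_tmap (f : H' →L[ℂ] H'') (g : K' →L[ℂ] K'') (f' : H →L[ℂ] H')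
    (g' : K →L[ℂ] K') (ζ : H ⊗ₕ K) : tmap f g (tmap f' g' ζ) = tmap (f ∘L f') (g ∘L g') ζ :=
  DFunLike.congr_fun (tmap_comp f g f' g') ζ

@[simp] lemma tmap_id : tmap (.id ℂ H) (.id ℂ K) = .id ℂ (H ⊗ₕ K) :=
  clm_ext fun h k => by simp

lemma norm_tmap_le (f : H →L[ℂ] H') (g : K →L[ℂ] K') : ‖tmap f g‖ ≤ ‖f‖ * ‖g‖ := by
  refine opNorm_le_bound _ (by positivity) fun ζ => ?_
  refine UniformSpace.Completion.induction_on
    (p := fun ζ => ‖tmap f g ζ‖ ≤ ‖f‖ * ‖g‖ * ‖ζ‖) ζ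
    (isClosed_le (tmap f g).continuous.norm (continuous_const.mul continuous_norm)) fun a => ?_
  have h_coe : tmap f g (ofAlg H K a) = ofAlg H' K' (TensorProduct.mapL f g a) :=
    ContinuousLinearMap.completion_apply_coe (TensorProduct.mapL f g) a
  change ‖tmap f g (ofAlg H K a)‖ ≤ ‖f‖ * ‖g‖ * ‖ofAlg H K a‖
  rw [h_coe, LinearIsometry.norm_map, LinearIsometry.norm_map]
  exact (TensorProduct.mapL f g).le_of_opNorm_le (TensorProduct.norm_mapL_le f g) a

/-- The tensor product of bounded operators, as a bounded bilinear map. -/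
def tmapL : (H →L[ℂ] H') →L[ℂ] (K →L[ℂ] K') →L[ℂ] (H ⊗ₕ K →L[ℂ] H' ⊗ₕ K') :=
  LinearMap.mkContinuous₂
    (LinearMap.mk₂ ℂ tmap (fun _ _ _ => clm_ext fun _ _ => by simp [add_tmul])
      (fun _ _ _ => clm_ext fun _ _ => by simp [smul_tmul])
      (fun _ _ _ => clm_ext fun _ _ => by simp [tmul_add])
      (fun _ _ _ => clm_ext fun _ _ => by simp [tmul_smul]))
    1 fun f g => by simpa using norm_tmap_le f g

@[simp] lemma tmapL_apply (f : H →L[ℂ] H') (g : K →L[ℂ] K') : tmapL f g = tmap f g := rfl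

variable (H K) in
/-- The operator `h ↦ |h⟩ ⊗ 1`. -/
def ketLeftL : H →L[ℂ] K →L[ℂ] H ⊗ₕ K :=
  compL ℂ K (H ⊗[ℂ] K) (H ⊗ₕ K) (ofAlg H K).toContinuousLinearMap ∘L TensorProduct.mkL ℂ H K

@[simp] lemma ketLeftL_apply (h : H) : ketLeftL H K h = ketLeft K h := rfl

@[fun_prop] lemma continuous_ketLeft : Continuous (ketLeft K : H → K →L[ℂ] H ⊗ₕ K) :=
  (ketLeftL H K).continuous

lemma eq_of_inner_tmul {ξ η : H ⊗ₕ K} (h : ∀ x y, ⟪tmul x y, ξ⟫_ℂ = ⟪tmul x y, η⟫_ℂ) :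
    ξ = η :=
  ext_inner_right ℂ fun ζ => DFunLike.congr_fun
    (clm_ext (f := innerSL ℂ ξ) (g := innerSL ℂ η) fun x y => by
      rw [innerSL_apply_apply, innerSL_apply_apply, ← inner_conj_symm, h, inner_conj_symm]) ζ

lemma tmap_adjoint [CompleteSpace H] [CompleteSpace K] [CompleteSpace H'] [CompleteSpace K']
    (f : H →L[ℂ] H') (g : K →L[ℂ] K') : (tmap f g).adjoint = tmap f.adjoint g.adjoint :=
  clm_ext fun x' y' => eq_of_inner_tmul fun x y => by simp [adjoint_inner_right]

@[simp] lemma ketLeft_adjoint_tmul [CompleteSpace K] (x h : H) (k : K) :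
    (ketLeft K x).adjoint (tmul h k) = ⟪x, h⟫_ℂ • k :=
  ext_inner_left ℂ fun y => by simp [adjoint_inner_right, inner_smul_right]

@[simp] lemma ketRight_adjoint_tmul [CompleteSpace H] (x k : K) (h : H) :
    (ketRight H x).adjoint (tmul h k) = ⟪x, k⟫_ℂ • h :=
  ext_inner_left ℂ fun y => by simp [adjoint_inner_right, inner_smul_right, mul_comm]

lemma ketLeft_adjoint_comp_ketLeft [CompleteSpace K] (x h : H) :
    (ketLeft K x).adjoint ∘L ketLeft K h = ⟪x, h⟫_ℂ • .id ℂ K := by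
  ext; simp

lemma ketRight_adjoint_comp_ketRight [CompleteSpace H] (x k : K) :
    (ketRight H x).adjoint ∘L ketRight H k = ⟪x, k⟫_ℂ • .id ℂ H := by
  ext; simp

lemma tmap_comp_ketLeft (f : H →L[ℂ] H') (g : K →L[ℂ] K') (h : H) :
    tmap f g ∘L ketLeft K h = ketLeft K' (f h) ∘L g := by
  ext; simp

@[simp] lemma flip_symm : (flip H K).symm = flip K H := rfl

@[simp] lemma flip_flip (ξ : H ⊗ₕ K) : flip K H (flip H K ξ) = ξ :=
  (flip H K).symm_apply_apply ξ

lemma flip_comp_ketLeft (h : H) :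
    (flip H K : H ⊗ₕ K →L[ℂ] K ⊗ₕ H) ∘L ketLeft K h = ketRight K h := by
  ext; simp

lemma flip_comp_ketRight (k : K) :
    (flip H K : H ⊗ₕ K →L[ℂ] K ⊗ₕ H) ∘L ketRight H k = ketLeft H k := by
  ext; simp

lemma flip_adjoint :
    (flip H K : H ⊗ₕ K →L[ℂ] K ⊗ₕ H).adjoint = (flip K H : K ⊗ₕ H →L[ℂ] H ⊗ₕ K) := by
  rw [LinearIsometryEquiv.adjoint_eq_symm, flip_symm]

end Calculus

section Legs

variable {H K L : Type*}
  [NormedAddCommGroup H] [InnerProductSpace ℂ H]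
  [NormedAddCommGroup K] [InnerProductSpace ℂ K]
  [NormedAddCommGroup L] [InnerProductSpace ℂ L]

lemma assoc_symm_tmul_left (h : H) (ξ : K ⊗ₕ L) :
    (assoc H K L).symm (tmul h ξ) = tmap (ketLeft K h) (.id ℂ L) ξ :=
  DFunLike.congr_fun (f := ((assoc H K L).symm : H ⊗ₕ (K ⊗ₕ L) →L[ℂ] (H ⊗ₕ K) ⊗ₕ L) ∘L
    ketLeft (K ⊗ₕ L) h) (g := tmap (ketLeft K h) (.id ℂ L)) (clm_ext fun k l => by simp) ξ

@[simp] lemma flip23_tmul (h : H) (k : K) (l : L) :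
    flip23 H K L (tmul (tmul h k) l) = tmul (tmul h l) k := by
  simp [flip23]

lemma flip23_tmul_right (ξ : H ⊗ₕ K) (l : L) :
    flip23 H K L (tmul ξ l) = tmap (ketRight H l) (.id ℂ K) ξ :=
  DFunLike.congr_fun (f := flip23 H K L ∘L ketRight (H ⊗ₕ K) l)
    (g := tmap (ketRight H l) (.id ℂ K)) (clm_ext fun k l => by simp) ξ

@[simp] lemma leg12_tmul (T : H ⊗ₕ K →L[ℂ] H ⊗ₕ K) (ξ : H ⊗ₕ K) (l : L) :
    leg12 L T (tmul ξ l) = tmul (T ξ) l := by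
  simp [leg12]

@[simp] lemma leg23_tmul (T : K ⊗ₕ L →L[ℂ] K ⊗ₕ L) (h : H) (k : K) (l : L) :
    leg23 H T (tmul (tmul h k) l) = tmap (ketLeft K h) (.id ℂ L) (T (tmul k l)) := by
  simp [leg23, assoc_symm_tmul_left]

@[simp] lemma leg13_tmul (T : H ⊗ₕ L →L[ℂ] H ⊗ₕ L) (h : H) (k : K) (l : L) :
    leg13 K T (tmul (tmul h k) l) = tmap (ketRight H k) (.id ℂ L) (T (tmul h l)) := by
  simp [leg13, flip23_tmul_right]

lemma leg23_comp_tmap_ketLeft (T : K ⊗ₕ L →L[ℂ] K ⊗ₕ L) (h : H) :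
    leg23 H T ∘L tmap (ketLeft K h) (.id ℂ L) = tmap (ketLeft K h) (.id ℂ L) ∘L T :=
  clm_ext fun k l => by simp

lemma leg13_comp_tmap_ketRight (T : H ⊗ₕ L →L[ℂ] H ⊗ₕ L) (k : K) :
    leg13 K T ∘L tmap (ketRight H k) (.id ℂ L) = tmap (ketRight H k) (.id ℂ L) ∘L T :=
  clm_ext fun k l => by simp

@[simp] lemma leg23_tmap_ketLeft (T : K ⊗ₕ L →L[ℂ] K ⊗ₕ L) (h : H) (ξ : K ⊗ₕ L) :
    leg23 H T (tmap (ketLeft K h) (.id ℂ L) ξ) = tmap (ketLeft K h) (.id ℂ L) (T ξ) :=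
  DFunLike.congr_fun (leg23_comp_tmap_ketLeft T h) ξ

@[simp] lemma leg13_tmap_ketRight (T : H ⊗ₕ L →L[ℂ] H ⊗ₕ L) (k : K) (ξ : H ⊗ₕ L) :
    leg13 K T (tmap (ketRight H k) (.id ℂ L) ξ) = tmap (ketRight H k) (.id ℂ L) (T ξ) :=
  DFunLike.congr_fun (leg13_comp_tmap_ketRight T k) ξ

lemma leg12_mul (S T : H ⊗ₕ K →L[ℂ] H ⊗ₕ K) : leg12 L (S * T) = leg12 L S * leg12 L T :=
  clm_ext fun _ _ => by simp

lemma leg23_mul (S T : K ⊗ₕ L →L[ℂ] K ⊗ₕ L) : leg23 H (S * T) = leg23 H S * leg23 H T :=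
  clm_ext₃ fun _ _ _ => by simp

lemma leg13_mul (S T : H ⊗ₕ L →L[ℂ] H ⊗ₕ L) : leg13 K (S * T) = leg13 K S * leg13 K T :=
  clm_ext₃ fun _ _ _ => by simp

@[simp] lemma leg12_one : leg12 L (1 : H ⊗ₕ K →L[ℂ] H ⊗ₕ K) = 1 := tmap_id

@[simp] lemma leg23_one : leg23 H (1 : K ⊗ₕ L →L[ℂ] K ⊗ₕ L) = 1 :=
  clm_ext₃ fun _ _ _ => by simp

@[simp] lemma leg13_one : leg13 K (1 : H ⊗ₕ L →L[ℂ] H ⊗ₕ L) = 1 :=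
  clm_ext₃ fun _ _ _ => by simp

lemma leg12_flip_mul_leg12_flip :
    leg12 L (flip H H : H ⊗ₕ H →L[ℂ] H ⊗ₕ H) * leg12 L (flip H H : H ⊗ₕ H →L[ℂ] H ⊗ₕ H) = 1 :=
  clm_ext₃ fun h k l => by simp

lemma leg12_flip_mul_leg13 (T : H ⊗ₕ L →L[ℂ] H ⊗ₕ L) :
    leg12 L (flip H H : H ⊗ₕ H →L[ℂ] H ⊗ₕ H) * leg13 H T =
      leg23 H T * leg12 L (flip H H : H ⊗ₕ H →L[ℂ] H ⊗ₕ H) := by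
  refine clm_ext₃ fun h k l => ?_
  simp [leg12, tmap_apply_tmap, flip_comp_ketRight]

lemma leg12_adjoint [CompleteSpace L] (T : H ⊗ₕ K →L[ℂ] H ⊗ₕ K) :
    (leg12 L T).adjoint = leg12 L T.adjoint := by
  rw [leg12, tmap_adjoint, adjoint_id, leg12]

lemma leg23_adjoint [CompleteSpace H] (T : K ⊗ₕ L →L[ℂ] K ⊗ₕ L) :
    (leg23 H T).adjoint = leg23 H T.adjoint := by
  simp only [leg23, adjoint_comp, LinearIsometryEquiv.adjoint_eq_symm, tmap_adjoint, adjoint_id,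
    LinearIsometryEquiv.symm_symm, comp_assoc]

lemma flip23_adjoint [CompleteSpace H] : (flip23 H K L).adjoint = flip23 H L K := by
  simp only [flip23, adjoint_comp, LinearIsometryEquiv.adjoint_eq_symm, tmap_adjoint, adjoint_id,
    LinearIsometryEquiv.symm_symm, flip_symm, comp_assoc]

lemma leg13_adjoint [CompleteSpace H] [CompleteSpace K] (T : H ⊗ₕ L →L[ℂ] H ⊗ₕ L) :
    (leg13 K T).adjoint = leg13 K T.adjoint := by
  simp only [leg13, adjoint_comp, flip23_adjoint, leg12_adjoint, comp_assoc]

lemma leg12_mem_unitary [CompleteSpace L] {T : H ⊗ₕ K →L[ℂ] H ⊗ₕ K} (hT : T ∈ unitary _) :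
    leg12 L T ∈ unitary ((H ⊗ₕ K) ⊗ₕ L →L[ℂ] (H ⊗ₕ K) ⊗ₕ L) :=
  Unitary.map_mem (⟨⟨⟨leg12 L, leg12_one⟩, leg12_mul⟩, fun T => (leg12_adjoint T).symm⟩ :
    (H ⊗ₕ K →L[ℂ] H ⊗ₕ K) →⋆* ((H ⊗ₕ K) ⊗ₕ L →L[ℂ] (H ⊗ₕ K) ⊗ₕ L)) hT

lemma leg23_mem_unitary [CompleteSpace H] {T : K ⊗ₕ L →L[ℂ] K ⊗ₕ L} (hT : T ∈ unitary _) :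
    leg23 H T ∈ unitary ((H ⊗ₕ K) ⊗ₕ L →L[ℂ] (H ⊗ₕ K) ⊗ₕ L) :=
  Unitary.map_mem (⟨⟨⟨leg23 H, leg23_one⟩, leg23_mul⟩, fun T => (leg23_adjoint T).symm⟩ :
    (K ⊗ₕ L →L[ℂ] K ⊗ₕ L) →⋆* ((H ⊗ₕ K) ⊗ₕ L →L[ℂ] (H ⊗ₕ K) ⊗ₕ L)) hT

lemma leg13_mem_unitary [CompleteSpace H] [CompleteSpace K] {T : H ⊗ₕ L →L[ℂ] H ⊗ₕ L}
    (hT : T ∈ unitary _) : leg13 K T ∈ unitary ((H ⊗ₕ K) ⊗ₕ L →L[ℂ] (H ⊗ₕ K) ⊗ₕ L) :=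
  Unitary.map_mem (⟨⟨⟨leg13 K, leg13_one⟩, leg13_mul⟩, fun T => (leg13_adjoint T).symm⟩ :
    (H ⊗ₕ L →L[ℂ] H ⊗ₕ L) →⋆* ((H ⊗ₕ K) ⊗ₕ L →L[ℂ] (H ⊗ₕ K) ⊗ₕ L)) hT

end Legs

namespace NaturalRightAbsorber

variable {C : HilbertTensorCategory.{u, v}} {H : Type u}
  [NormedAddCommGroup H] [InnerProductSpace ℂ H] [CompleteSpace H] {ρ : C.Obj H}

lemma U_triv_unit (A : NaturalRightAbsorber C ρ) : A.U (C.triv CUnit.{u}) = 1 := by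
  set u := A.U (C.triv CUnit.{u})
  let e : CUnit.{u} := ⟨1⟩
  have ket_eq : ketLeft CUnit.{u} e = ketRight CUnit.{u} e := by
    ext c
    have hc : c = c.down • e := by ext; simp [e]
    rw [ketLeft_apply, ketRight_apply, hc, smul_tmul, tmul_smul]
  have natural_ket : A.U (C.tensor (C.triv CUnit) (C.triv CUnit)) ∘L
      tmap (ketLeft CUnit.{u} e) (.id ℂ H) = tmap (ketLeft CUnit.{u} e) (.id ℂ H) ∘L u :=
    A.natural (by rw [← C.triv_tensor]; exact C.triv_hom _)
  have u_sq : u ∘L u = u := by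
    rw [A.tensor_eq, comp_assoc, leg23_comp_tmap_ketLeft, ket_eq, ← comp_assoc,
      leg13_comp_tmap_ketRight, comp_assoc] at natural_ket
    have h_cancel := congrArg ((tmap (ketRight CUnit.{u} e).adjoint (.id ℂ H)) ∘L ·) natural_ket
    have norm_e : ⟪e, e⟫_ℂ = 1 := by change ⟪(1 : ℂ), 1⟫_ℂ = 1; simp
    simpa only [← comp_assoc, tmap_comp, ketRight_adjoint_comp_ketRight, norm_e, one_smul,
      tmap_id, ContinuousLinearMap.id_comp] using h_cancel
  have h_unit : IsUnit u := Unitary.isUnit_coe (U := ⟨u, A.unitary_mem _⟩)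
  exact h_unit.mul_eq_left.1 u_sq

lemma U_triv (A : NaturalRightAbsorber C ρ) (K : Type u) [NormedAddCommGroup K]
    [InnerProductSpace ℂ K] [CompleteSpace K] : A.U (C.triv K) = 1 := by
  refine clm_ext fun k h => ?_
  let a : CUnit.{u} →L[ℂ] K := toSpanSingleton ℂ k ∘L
    (ContinuousLinearEquiv.ulift : CUnit.{u} ≃L[ℂ] ℂ).toContinuousLinearMap
  have ha : a ⟨1⟩ = k := one_smul ℂ k
  simpa [U_triv_unit, ha] using DFunLike.congr_fun (A.natural (C.triv_hom a)) (tmul ⟨1⟩ h)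

lemma leg23_mul_leg12 (A : NaturalRightAbsorber C ρ) {L : Type u} [NormedAddCommGroup L]
    [InnerProductSpace ℂ L] [CompleteSpace L] {σ : C.Obj L} (B : NaturalRightAbsorber C σ)
    {K : Type u} [NormedAddCommGroup K] [InnerProductSpace ℂ K] [CompleteSpace K] (x : C.Obj K) :
    leg23 K (B.U ρ) * leg12 L (A.U x) = leg12 L (A.U x) * leg13 H (B.U x) * leg23 K (B.U ρ) := by
  have h := B.natural (A.hom_mem x)
  rwa [B.tensor_eq, B.tensor_eq, U_triv, leg13_one] at h

lemma isMultiplicativeUnitary (A : NaturalRightAbsorber C ρ) : IsMultiplicativeUnitary (A.U ρ) :=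
  ⟨A.unitary_mem ρ, A.leg23_mul_leg12 A ρ⟩

end NaturalRightAbsorber

section ConjSpace

@[simp] lemma ofConj_toConj {H : Type*} (x : H) : ofConj (toConj x) = x := rfl

@[simp] lemma toConj_ofConj {H : Type*} (x : ConjSpace H) : toConj (ofConj x) = x := rfl

variable {H K : Type*} [NormedAddCommGroup H] [InnerProductSpace ℂ H]
  [NormedAddCommGroup K] [InnerProductSpace ℂ K]

instance [CompleteSpace H] : CompleteSpace (ConjSpace H) := inferInstanceAs (CompleteSpace H)

variable (H) in
/-- The identification `x ↦ x̄` of a Hilbert space with its complex conjugate, as a conjugate-linear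
isometric isomorphism. -/
def toConjₗᵢ : H ≃ₗᵢ⋆[ℂ] ConjSpace H where
  toFun := toConj
  map_add' _ _ := rfl
  map_smul' c x := show c • x = starRingEnd ℂ (starRingEnd ℂ c) • x by rw [Complex.conj_conj]
  invFun := ofConj
  norm_map' _ := rfl

@[simp] lemma toConjₗᵢ_apply (x : H) : toConjₗᵢ H x = toConj x := rfl

@[simp] lemma toConjₗᵢ_symm_apply (x : ConjSpace H) : (toConjₗᵢ H).symm x = ofConj x := rfl

lemma inner_map_map_of_antilinear (f : H →ₗᵢ⋆[ℂ] K) (x y : H) : ⟪f x, f y⟫_ℂ = ⟪y, x⟫_ℂ :=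
  ((toConjₗᵢ K).toLinearIsometry.comp f).inner_map_map y x

variable (H K) in
/-- The antiunitary operator `J : H̄ ⊗ K → K̄ ⊗ H`, `x̄ ⊗ y ↦ ȳ ⊗ x`. -/
def conjFlip : ConjSpace H ⊗ₕ K →ₗᵢ⋆[ℂ] ConjSpace K ⊗ₕ H :=
  (toConjₗᵢ (ConjSpace K ⊗ₕ H)).symm.toLinearIsometry.comp
    (liftIsometry (LinearMap.mk₂ ℂ
      (fun x y => toConjₗᵢ (ConjSpace K ⊗ₕ H) (tmul (toConjₗᵢ K y) ((toConjₗᵢ H).symm x)))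
      (fun _ _ _ => by simp only [map_add, tmul_add])
      (fun _ _ _ => by simp only [map_smulₛₗ, tmul_smul, RingHomCompTriple.comp_apply,
        RingHom.id_apply])
      (fun _ _ _ => by simp only [map_add, add_tmul])
      (fun _ _ _ => by simp only [map_smulₛₗ, smul_tmul, RingHomCompTriple.comp_apply,
        RingHom.id_apply]))
      fun x x' y y' => (inner_tmul (toConj y') (toConj y) (ofConj x') (ofConj x)).trans
        (mul_comm _ _))

@[simp] lemma conjFlip_tmul (x : ConjSpace H) (y : K) :
    conjFlip H K (tmul x y) = tmul (toConj y) (ofConj x) := by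
  simp [conjFlip]

@[simp] lemma conjFlip_conjFlip (ξ : ConjSpace H ⊗ₕ K) : conjFlip K H (conjFlip H K ξ) = ξ :=
  eq_of_inner_tmul fun x y => by
    calc ⟪tmul x y, conjFlip K H (conjFlip H K ξ)⟫_ℂ
        = ⟪conjFlip K H (conjFlip H K (tmul x y)), conjFlip K H (conjFlip H K ξ)⟫_ℂ := by simp
      _ = ⟪tmul x y, ξ⟫_ℂ := by simp only [inner_map_map_of_antilinear]

lemma ketRight_adjoint_conjFlip [CompleteSpace K] (e : H) (ξ : ConjSpace H ⊗ₕ K) :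
    (ketRight (ConjSpace K) e).adjoint (conjFlip H K ξ) =
      toConj ((ketLeft K (toConj e)).adjoint ξ) := by
  refine ext_inner_left ℂ fun k => ?_
  calc ⟪k, (ketRight (ConjSpace K) e).adjoint (conjFlip H K ξ)⟫_ℂ
      = ⟪conjFlip H K (tmul (toConj e) (ofConj k)), conjFlip H K ξ⟫_ℂ := by
        rw [adjoint_inner_right, conjFlip_tmul]; rfl
    _ = ⟪(ketLeft K (toConj e)).adjoint ξ, ofConj k⟫_ℂ := by
        rw [inner_map_map_of_antilinear, adjoint_inner_left, ketLeft_apply]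
    _ = ⟪k, toConj ((ketLeft K (toConj e)).adjoint ξ)⟫_ℂ := rfl

end ConjSpace

section SelfAdjoint

variable {H : Type*} [NormedAddCommGroup H] [InnerProductSpace ℂ H] [CompleteSpace H]
  {Q : H →ₗ.[ℂ] H}

lemma inner_apply_eq_of_isSelfAdjoint (hQ : IsSelfAdjoint Q) (u v : Q.domain) :
    ⟪Q u, (v : H)⟫_ℂ = ⟪(u : H), Q v⟫_ℂ := by
  have h := LinearPMap.adjoint_isFormalAdjoint hQ.dense_domain
  rw [LinearPMap.isSelfAdjoint_def.1 hQ] at h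
  exact h u v

lemma exists_apply_eq_of_isSelfAdjoint (hQ : IsSelfAdjoint Q) {s t : H}
    (h : ∀ u : Q.domain, ⟪t, (u : H)⟫_ℂ = ⟪s, Q u⟫_ℂ) : ∃ u : Q.domain, (u : H) = s ∧ Q u = t := by
  have hs : s ∈ Q.adjoint.domain := LinearPMap.mem_adjoint_domain_of_exists s ⟨t, h⟩
  have ht : Q.adjoint ⟨s, hs⟩ = t := LinearPMap.adjoint_apply_eq hQ.dense_domain ⟨s, hs⟩ h
  have h_adjoint : ∃ u : Q.adjoint.domain, (u : H) = s ∧ Q.adjoint u = t := ⟨⟨s, hs⟩, rfl, ht⟩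
  rwa [LinearPMap.isSelfAdjoint_def.1 hQ] at h_adjoint

lemma denseRange_of_isSelfAdjoint (hQ : IsSelfAdjoint Q)
    (hker : ∀ u : Q.domain, Q u = 0 → u = 0) : DenseRange (Q : Q.domain → H) := by
  suffices h : Dense ((LinearMap.range Q.toFun : Submodule ℂ H) : Set H) from h
  rw [Submodule.dense_iff_topologicalClosure_eq_top, Submodule.topologicalClosure_eq_top_iff,
    Submodule.eq_bot_iff]
  intro s hs
  rw [Submodule.mem_orthogonal'] at hs
  obtain ⟨u, rfl, hu⟩ := exists_apply_eq_of_isSelfAdjoint hQ (s := s) (t := 0) fun u => by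
    exact inner_zero_left _ |>.trans (hs _ ⟨u, rfl⟩).symm
  rw [hker u hu, ZeroMemClass.coe_zero]

lemma inner_tensorSquareGraph (hQ : IsSelfAdjoint Q) (x u : Q.domain)
    {p : (H ⊗ₕ H) × (H ⊗ₕ H)} (hp : p ∈ tensorSquareGraph Q) :
    ⟪tmul (Q x) (Q u), p.1⟫_ℂ = ⟪tmul (x : H) (u : H), p.2⟫_ℂ := by
  let f : (H ⊗ₕ H) × (H ⊗ₕ H) →L[ℂ] ℂ :=
    innerSL ℂ (tmul (Q x) (Q u)) ∘L ContinuousLinearMap.fst ℂ _ _ -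
      innerSL ℂ (tmul (x : H) (u : H)) ∘L ContinuousLinearMap.snd ℂ _ _
  have hf : f p ∈ (⊥ : Submodule ℂ ℂ) :=
    (forall_mem_closedSpan_iff f isClosed_singleton).2
      (fun q => by simp [f, inner_apply_eq_of_isSelfAdjoint hQ]) p hp
  exact sub_eq_zero.1 hf

end SelfAdjoint

section Managed

variable {H : Type*} [NormedAddCommGroup H] [InnerProductSpace ℂ H] [CompleteSpace H]
  {W : H ⊗ₕ H →L[ℂ] H ⊗ₕ H} {Q : H →ₗ.[ℂ] H} {W' : ConjSpace H ⊗ₕ H →L[ℂ] ConjSpace H ⊗ₕ H}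

/-- The part of manageability, with `W̃ = W'`, that makes the slices of `W` a `C*`-algebra. The
relation of `W` to `W'` is required with `Q` moved through either leg, so that the notion is
invariant under passing from `W` to its dual. -/
structure IsManaged (W : H ⊗ₕ H →L[ℂ] H ⊗ₕ H) (Q : H →ₗ.[ℂ] H)
    (W' : ConjSpace H ⊗ₕ H →L[ℂ] ConjSpace H ⊗ₕ H) : Prop where
  isSelfAdjoint : IsSelfAdjoint Q
  denseRange : DenseRange (Q : Q.domain → H)
  surjective : Function.Surjective W'
  inner_snd : ∀ (x z : H) (u v : Q.domain), ⟪tmul x (u : H), W (tmul z (Q v))⟫_ℂ =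
    ⟪tmul (toConj z) (Q u), W' (tmul (toConj x) (v : H))⟫_ℂ
  inner_fst : ∀ (x z : Q.domain) (u v : H), ⟪tmul (Q x) u, W (tmul (z : H) v)⟫_ℂ =
    ⟪tmul (toConj (Q z)) u, W' (tmul (toConj (x : H)) v)⟫_ℂ

lemma IsManageable.exists_isManaged (hW : IsManageable W) : ∃ Q W', IsManaged W Q W' := by
  obtain ⟨Q, W', hQ, -, hker, hW', hgraph, hinner⟩ := hW
  have hrange := denseRange_of_isSelfAdjoint hQ hker
  refine ⟨Q, W', hQ, hrange, (Unitary.linearIsometryEquiv ⟨W', hW'⟩).surjective, hinner,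
    fun x z u v => ?_⟩
  have inner_fst_of_mem : ∀ u v : Q.domain, ⟪tmul (Q x) (Q u), W (tmul (z : H) (v : H))⟫_ℂ =
      ⟪tmul (toConj (Q z)) (Q u), W' (tmul (toConj (x : H)) (v : H))⟫_ℂ := fun u v => by
    have hmem : (tmul (z : H) (v : H), tmul (Q z) (Q v)) ∈ tensorSquareGraph Q :=
      mem_closedSpan _ (z, v)
    rw [inner_tensorSquareGraph hQ x u ((hgraph _ _).2 hmem), hinner]
  refine hrange.induction_on u (isClosed_eq ((ketLeft H (Q x)).continuous.inner continuous_const)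
    ((ketLeft H (toConj (Q z))).continuous.inner continuous_const)) fun u => ?_
  exact hQ.dense_domain.denseRange_val.induction_on v
    (isClosed_eq (continuous_const.inner (W ∘L ketLeft H (z : H)).continuous)
      (continuous_const.inner (W' ∘L ketLeft H (toConj (x : H))).continuous)) (inner_fst_of_mem u)

/-- The dual `Ŵ = Σ W* Σ` of a multiplicative unitary. -/
def dualUnitary (W : H ⊗ₕ H →L[ℂ] H ⊗ₕ H) : H ⊗ₕ H →L[ℂ] H ⊗ₕ H :=
  (flip H H : H ⊗ₕ H →L[ℂ] H ⊗ₕ H) ∘L W.adjoint ∘L (flip H H : H ⊗ₕ H →L[ℂ] H ⊗ₕ H)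

omit [CompleteSpace H] in
lemma inner_dualUnitary (W : H ⊗ₕ H →L[ℂ] H ⊗ₕ H) (x u z y : H) :
    ⟪tmul x u, dualUnitary W (tmul z y)⟫_ℂ = ⟪W (tmul u x), tmul y z⟫_ℂ := by
  rw [← flip_tmul u x]
  change ⟪flip H H (tmul u x), flip H H (W.adjoint (flip H H (tmul z y)))⟫_ℂ = _
  rw [LinearIsometryEquiv.inner_map_map, adjoint_inner_right, flip_tmul]

lemma IsManaged.dual (h : IsManaged W Q W') :
    IsManaged (dualUnitary W) Q
      ((conjFlip H H).toContinuousLinearMap.comp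
        (W'.comp (conjFlip H H).toContinuousLinearMap)) where
  isSelfAdjoint := h.isSelfAdjoint
  denseRange := h.denseRange
  surjective := by
    have hJ : Function.Surjective (conjFlip H H) := fun ξ =>
      ⟨conjFlip H H ξ, conjFlip_conjFlip ξ⟩
    exact hJ.comp (h.surjective.comp hJ)
  inner_snd x z u v := by
    rw [inner_dualUnitary, ← inner_conj_symm, h.inner_fst, inner_conj_symm,
      ← inner_map_map_of_antilinear (conjFlip H H), conjFlip_tmul]
    simp
  inner_fst x z u v := by
    rw [inner_dualUnitary, ← inner_conj_symm, h.inner_snd, inner_conj_symm,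
      ← inner_map_map_of_antilinear (conjFlip H H), conjFlip_tmul]
    simp

end Managed

section LeftStable

variable {ι E F : Type*} [NormedAddCommGroup E] [NormedSpace ℂ E]
  [NormedAddCommGroup F] [InnerProductSpace ℂ F] [CompleteSpace F]

/-- Left multiplication by `T` leaves the space `M` of operators invariant, and so does its inverse:
`T M = M` for invertible `T`. -/
def LeftStable (T : F →L[ℂ] F) (M : Submodule ℂ (E →L[ℂ] F)) : Prop :=
  ∀ S, T ∘L S ∈ M ↔ S ∈ M

lemma adjoint_comp_comp_of_mem_unitary {T : F →L[ℂ] F} (hT : T ∈ unitary (F →L[ℂ] F))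
    (S : E →L[ℂ] F) : T.adjoint ∘L T ∘L S = S :=
  congrArg (fun R => R ∘L S) (Unitary.mem_iff.1 hT).1

lemma comp_adjoint_comp_of_mem_unitary {T : F →L[ℂ] F} (hT : T ∈ unitary (F →L[ℂ] F))
    (S : E →L[ℂ] F) : T ∘L T.adjoint ∘L S = S :=
  congrArg (fun R => R ∘L S) (Unitary.mem_iff.1 hT).2

lemma LeftStable.adjoint {T : F →L[ℂ] F} {M : Submodule ℂ (E →L[ℂ] F)} (h : LeftStable T M)
    (hT : T ∈ unitary (F →L[ℂ] F)) : LeftStable T.adjoint M := fun S => by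
  rw [← h, comp_adjoint_comp_of_mem_unitary hT]

lemma leftStable_closedSpan_iff {T : F →L[ℂ] F} (hT : T ∈ unitary (F →L[ℂ] F))
    {g : ι → E →L[ℂ] F} : LeftStable T (closedSpan g) ↔ ∀ N : Submodule ℂ (E →L[ℂ] F),
      IsClosed (N : Set (E →L[ℂ] F)) → ((∀ i, T ∘L g i ∈ N) ↔ ∀ i, g i ∈ N) := by
  refine ⟨fun h N hN => ?_, fun h S => ?_⟩
  · suffices (∀ S ∈ closedSpan g, T ∘L S ∈ N) ↔ closedSpan g ≤ N from
      (forall_mem_closedSpan_iff (compL ℂ E F F T) hN).symm.trans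
        (this.trans (closedSpan_le_iff hN))
    refine ⟨fun hTN S hS => ?_, fun hgN S hS => hgN ((h S).2 hS)⟩
    have hS' := hTN (T.adjoint ∘L S) ((h.adjoint hT S).2 hS)
    rwa [comp_adjoint_comp_of_mem_unitary hT] at hS'
  · have hT_mem := (forall_mem_closedSpan_iff (compL ℂ E F F T) (isClosed_closedSpan g)).2
      ((h _ (isClosed_closedSpan g)).2 (mem_closedSpan g))
    let N := (closedSpan g).comap (compL ℂ E F F T.adjoint).toLinearMap
    have hN : IsClosed (N : Set (E →L[ℂ] F)) :=
      (isClosed_closedSpan g).preimage (compL ℂ E F F T.adjoint).continuous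
    have hg : ∀ i, T ∘L g i ∈ N := fun i => by
      change T.adjoint ∘L T ∘L g i ∈ closedSpan g
      rw [adjoint_comp_comp_of_mem_unitary hT]
      exact mem_closedSpan g i
    refine ⟨fun hS => ?_, hT_mem S⟩
    have hS' : T ∘L S ∈ N := (closedSpan_le_iff hN).2 ((h N hN).1 hg) hS
    rwa [← adjoint_comp_comp_of_mem_unitary hT S]

end LeftStable

section Slice

variable {H K L F : Type*} [NormedAddCommGroup H] [InnerProductSpace ℂ H]
  [NormedAddCommGroup K] [InnerProductSpace ℂ K]
  [NormedAddCommGroup L] [InnerProductSpace ℂ L] [CompleteSpace L]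
  [NormedAddCommGroup F] [NormedSpace ℂ F]

/-- The slice `(ω ⊗ id) W` at the vector functional `ω = ⟪x, · z⟫`. -/
def leftSlice (W : H ⊗ₕ K →L[ℂ] H ⊗ₕ L) (x z : H) : K →L[ℂ] L :=
  (ketLeft L x).adjoint ∘L W ∘L ketLeft K z

lemma inner_leftSlice (W : H ⊗ₕ K →L[ℂ] H ⊗ₕ L) (x z : H) (l : L) (k : K) :
    ⟪l, leftSlice W x z k⟫_ℂ = ⟪tmul x l, W (tmul z k)⟫_ℂ := by
  simp [leftSlice, adjoint_inner_right]

lemma leftSlice_adjoint [CompleteSpace H] [CompleteSpace K] (W : H ⊗ₕ K →L[ℂ] H ⊗ₕ L) (x z : H) :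
    (leftSlice W x z).adjoint = leftSlice W.adjoint z x := by
  simp only [leftSlice, adjoint_comp, adjoint_adjoint, comp_assoc]

@[fun_prop] lemma continuous_leftSlice_fst (W : H ⊗ₕ K →L[ℂ] H ⊗ₕ L) (z : H) :
    Continuous fun x => leftSlice W x z :=
  ((adjoint (𝕜 := ℂ) (E := L) (F := H ⊗ₕ L)).continuous.comp continuous_ketLeft).clm_comp
    continuous_const

@[fun_prop] lemma continuous_leftSlice_snd (W : H ⊗ₕ K →L[ℂ] H ⊗ₕ L) (x : H) :
    Continuous fun z => leftSlice W x z :=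
  continuous_const.clm_comp (continuous_const.clm_comp continuous_ketLeft)

lemma leftSlice_mem_quantumAlgebra (W : L ⊗ₕ L →L[ℂ] L ⊗ₕ L) (x z : L) :
    leftSlice W x z ∈ quantumAlgebra W :=
  mem_closedSpan _ (x, z)

lemma forall_mem_quantumAlgebra_iff {σ : ℂ →+* ℂ} {W : L ⊗ₕ L →L[ℂ] L ⊗ₕ L}
    (f : (L →L[ℂ] L) →SL[σ] F) {N : Submodule ℂ F} (hN : IsClosed (N : Set F)) :
    (∀ a ∈ quantumAlgebra W, f a ∈ N) ↔ ∀ x z, f (leftSlice W x z) ∈ N :=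
  (forall_mem_closedSpan_iff f hN).trans Prod.forall

variable (K) in
/-- The closed linear span of the operators `|k⟩ ⊗ a` for `k ∈ K` and `a ∈ A`: the Hilbert
`A`-module `K ⊗ A`. -/
def columnModule (A : Submodule ℂ (L →L[ℂ] L)) : Submodule ℂ (L →L[ℂ] K ⊗ₕ L) :=
  closedSpan fun p : K × A => ketLeft L p.1 ∘L (p.2 : L →L[ℂ] L)

omit [CompleteSpace L] in
lemma ketLeft_comp_mem_columnModule {A : Submodule ℂ (L →L[ℂ] L)} (k : K) {a : L →L[ℂ] L}
    (ha : a ∈ A) : ketLeft L k ∘L a ∈ columnModule K A :=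
  mem_closedSpan (fun p : K × A => ketLeft L p.1 ∘L (p.2 : L →L[ℂ] L)) (k, ⟨a, ha⟩)

omit [CompleteSpace L] in
lemma forall_mem_columnModule_iff {σ : ℂ →+* ℂ} {A : Submodule ℂ (L →L[ℂ] L)}
    (f : (L →L[ℂ] K ⊗ₕ L) →SL[σ] F) {N : Submodule ℂ F} (hN : IsClosed (N : Set F)) :
    (∀ T ∈ columnModule K A, f T ∈ N) ↔ ∀ k, ∀ a ∈ A, f (ketLeft L k ∘L a) ∈ N :=
  (forall_mem_closedSpan_iff f hN).trans (by simp only [Prod.forall, Subtype.forall])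

omit [CompleteSpace L] in
lemma leftStable_columnModule_iff [CompleteSpace K] {T : K ⊗ₕ L →L[ℂ] K ⊗ₕ L}
    (hT : T ∈ unitary (K ⊗ₕ L →L[ℂ] K ⊗ₕ L)) {A : Submodule ℂ (L →L[ℂ] L)} :
    LeftStable T (columnModule K A) ↔
      ∀ N : Submodule ℂ (L →L[ℂ] K ⊗ₕ L), IsClosed (N : Set (L →L[ℂ] K ⊗ₕ L)) →
        ((∀ k, ∀ a ∈ A, T ∘L ketLeft L k ∘L a ∈ N) ↔ ∀ k, ∀ a ∈ A, ketLeft L k ∘L a ∈ N) := by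
  rw [columnModule, leftStable_closedSpan_iff hT]
  simp only [Prod.forall, Subtype.forall]

end Slice

section SlicedRelation

variable {H K L : Type*} [NormedAddCommGroup H] [InnerProductSpace ℂ H]
  [NormedAddCommGroup K] [InnerProductSpace ℂ K] [CompleteSpace K]
  [NormedAddCommGroup L] [InnerProductSpace ℂ L] [CompleteSpace L]

lemma tmap_ketRight_adjoint_comp_ketLeft (x : H) (k : K) :
    tmap ((ketRight K x).adjoint ∘L ketLeft H k) (.id ℂ L) = ketLeft L k ∘L (ketLeft L x).adjoint :=
  clm_ext fun h l => by simp [smul_tmul]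

omit [CompleteSpace L] in
lemma tmap_ketRight_adjoint_comp_leg13 (V : K ⊗ₕ L →L[ℂ] K ⊗ₕ L) (x : H) :
    tmap (ketRight K x).adjoint (.id ℂ L) ∘L leg13 H V =
      V ∘L tmap (ketRight K x).adjoint (.id ℂ L) := by
  refine clm_ext₃ fun k h l => ?_
  have h_smul : tmap (⟪x, h⟫_ℂ • .id ℂ K) (.id ℂ L) = ⟪x, h⟫_ℂ • .id ℂ (K ⊗ₕ L) :=
    clm_ext fun k l => by simp [smul_tmul]
  simp [tmap_apply_tmap, ketRight_adjoint_comp_ketRight, smul_tmul, h_smul]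

lemma tmap_ketRight_adjoint_leg23_ketLeft (W : H ⊗ₕ L →L[ℂ] H ⊗ₕ L) (x z : H) (k : K) :
    tmap (ketRight K x).adjoint (.id ℂ L) ∘L leg23 K W ∘L ketLeft L (tmul k z) =
      ketLeft L k ∘L leftSlice W x z := by
  ext y
  simp [tmap_apply_tmap, tmap_ketRight_adjoint_comp_ketLeft, leftSlice]

omit [CompleteSpace K] [CompleteSpace L] in
lemma tmap_leg12_leg23_ketLeft (S : K ⊗ₕ H →L[ℂ] K) (T : K ⊗ₕ H →L[ℂ] K ⊗ₕ H)
    (W : H ⊗ₕ L →L[ℂ] H ⊗ₕ L) (z : H) (k : K) :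
    tmap S (.id ℂ L) ∘L leg12 L T ∘L leg23 K W ∘L ketLeft L (tmul k z) =
      tmap (S ∘L T ∘L ketLeft H k) (.id ℂ L) ∘L W ∘L ketLeft L z := by
  ext y
  simp [leg12, tmap_apply_tmap]

/-- The relation is `V'₁₃ W₂₃ = V₁₂* W₂₃ V₁₂`. Slice its middle leg; as `V` is onto, the last
factor `V₁₂` does not affect the closed linear span of the result. -/
lemma forall_comp_leftSlice_mem_iff {V : K ⊗ₕ H →L[ℂ] K ⊗ₕ H} {V' : K ⊗ₕ L →L[ℂ] K ⊗ₕ L}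
    {W : H ⊗ₕ L →L[ℂ] H ⊗ₕ L} (hV : V ∈ unitary (K ⊗ₕ H →L[ℂ] K ⊗ₕ H))
    (hVW : leg23 K W * leg12 L V = leg12 L V * leg13 H V' * leg23 K W) (x : H)
    {N : Submodule ℂ (L →L[ℂ] K ⊗ₕ L)} (hN : IsClosed (N : Set (L →L[ℂ] K ⊗ₕ L))) :
    (∀ k z, V' ∘L ketLeft L k ∘L leftSlice W x z ∈ N) ↔
      ∀ k z, tmap ((ketRight K x).adjoint ∘L V.adjoint ∘L ketLeft H k) (.id ℂ L) ∘L
        W ∘L ketLeft L z ∈ N := by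
  let S := tmap (ketRight K x).adjoint (.id ℂ L)
  let slice (R : (K ⊗ₕ H) ⊗ₕ L →L[ℂ] (K ⊗ₕ H) ⊗ₕ L) : K ⊗ₕ H →L[ℂ] L →L[ℂ] K ⊗ₕ L :=
    compL ℂ L _ _ (S ∘L R) ∘L ketLeftL _ L
  have h13 (k : K) (z : H) :
      slice (leg13 H V' ∘L leg23 K W) (tmul k z) = V' ∘L ketLeft L k ∘L leftSlice W x z := by
    rw [← tmap_ketRight_adjoint_leg23_ketLeft, ← comp_assoc V',
      ← tmap_ketRight_adjoint_comp_leg13]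
    rfl
  have h12 (k : K) (z : H) : slice (leg12 L V.adjoint ∘L leg23 K W) (tmul k z) =
      tmap ((ketRight K x).adjoint ∘L V.adjoint ∘L ketLeft H k) (.id ℂ L) ∘L
        W ∘L ketLeft L z := by
    rw [← tmap_leg12_leg23_ketLeft]
    rfl
  have h_eq (ζ : K ⊗ₕ H) : slice (leg13 H V' ∘L leg23 K W) ζ =
      slice (leg12 L V.adjoint ∘L leg23 K W) (V ζ) := by
    have h_rel : leg13 H V' ∘L leg23 K W = leg12 L V.adjoint ∘L leg23 K W ∘L leg12 L V := by
      rw [← leg12_adjoint, ← mul_def (leg23 K W), hVW, mul_assoc]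
      exact (adjoint_comp_comp_of_mem_unitary (leg12_mem_unitary hV) _).symm
    have h_ket : leg12 L V ∘L ketLeft L ζ = ketLeft L (V ζ) := by ext; simp
    simp only [slice, comp_apply, compL_apply, ketLeftL_apply, h_rel, comp_assoc, h_ket]
  have hV_surj : Function.Surjective V := (Unitary.linearIsometryEquiv ⟨V, hV⟩).surjective
  simp only [← h13, ← h12]
  rw [← forall_htensor_mem_iff _ hN, ← forall_htensor_mem_iff _ hN]
  simp only [h_eq]
  exact (hV_surj.forall (p := fun ζ => slice (leg12 L V.adjoint ∘L leg23 K W) ζ ∈ N)).symm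

end SlicedRelation

section SliceMap

variable {H K L : Type*} [NormedAddCommGroup H] [InnerProductSpace ℂ H]
  [NormedAddCommGroup K] [InnerProductSpace ℂ K] [CompleteSpace K]
  [NormedAddCommGroup L] [InnerProductSpace ℂ L]

/-- The operator `Φ : L ⊗ H → 𝔹(K, H ⊗ K)` with `Φ (p ⊗ e) = |e⟩ ⊗ (⟨q| ⊗ 1) T (|p⟩ ⊗ 1)`. -/
def sliceMap (T : L ⊗ₕ K →L[ℂ] L ⊗ₕ K) (q : L) : L ⊗ₕ H →L[ℂ] K →L[ℂ] H ⊗ₕ K :=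
  compL ℂ K _ _ (tmap (.id ℂ H) ((ketLeft K q).adjoint ∘L T) ∘L
    (assoc H L K : (H ⊗ₕ L) ⊗ₕ K →L[ℂ] H ⊗ₕ (L ⊗ₕ K))) ∘L
    ketLeftL _ K ∘L (flip L H : L ⊗ₕ H →L[ℂ] H ⊗ₕ L)

lemma sliceMap_tmul (T : L ⊗ₕ K →L[ℂ] L ⊗ₕ K) (q p : L) (e : H) :
    sliceMap T q (tmul p e) = ketLeft K e ∘L leftSlice T q p := by
  ext y
  simp [sliceMap, leftSlice]

lemma inner_sliceMap [CompleteSpace L] (T : L ⊗ₕ K →L[ℂ] L ⊗ₕ K) (q : L) (ξ : L ⊗ₕ H) (e : H)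
    (f y : K) :
    ⟪tmul e f, sliceMap T q ξ y⟫_ℂ = ⟪tmul q f, T (tmul ((ketRight L e).adjoint ξ) y)⟫_ℂ := by
  have h : innerSL ℂ (tmul e f) ∘L ContinuousLinearMap.apply ℂ (H ⊗ₕ K) y ∘L sliceMap T q =
      innerSL ℂ (tmul q f) ∘L T ∘L ketRight L y ∘L (ketRight L e).adjoint :=
    clm_ext fun p h => by simp [sliceMap_tmul, inner_leftSlice]
  exact DFunLike.congr_fun h ξ

end SliceMap

section ManagedAlgebra

variable {H : Type*} [NormedAddCommGroup H] [InnerProductSpace ℂ H] [CompleteSpace H]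

namespace IsManaged

variable {W : H ⊗ₕ H →L[ℂ] H ⊗ₕ H} {Q : H →ₗ.[ℂ] H}
  {W' : ConjSpace H ⊗ₕ H →L[ℂ] ConjSpace H ⊗ₕ H}

lemma leftSlice_eq (h : IsManaged W Q W') (p z : Q.domain) :
    leftSlice W' (toConj (Q z)) (toConj (p : H)) = leftSlice W (Q p) z := by
  ext y
  refine ext_inner_left ℂ fun u => ?_
  rw [inner_leftSlice, inner_leftSlice, h.inner_fst]

lemma tmap_comp_ketLeft_eq (h : IsManaged W Q W') (k : H) (v z : Q.domain) :
    tmap ((ketRight H (Q v)).adjoint ∘L W.adjoint ∘L ketLeft H k) (.id ℂ H) ∘L W ∘L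
      ketLeft H (z : H) =
    sliceMap W' (toConj (Q z)) (conjFlip H H (W' (tmul (toConj k) (v : H)))) := by
  set T := (ketRight H (Q v)).adjoint ∘L W.adjoint ∘L ketLeft H k with hT
  ext y
  refine eq_of_inner_tmul fun e f => ?_
  obtain ⟨s, hs, hQs⟩ : ∃ s : Q.domain,
      (s : H) = (ketLeft H (toConj e)).adjoint (W' (tmul (toConj k) (v : H))) ∧
        Q s = T.adjoint e :=
    exists_apply_eq_of_isSelfAdjoint h.isSelfAdjoint fun u => by
      rw [adjoint_inner_left, adjoint_inner_left, ketLeft_apply, ← inner_conj_symm (𝕜 := ℂ) (W' _),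
        ← h.inner_snd, inner_conj_symm, hT, comp_apply, comp_apply, adjoint_inner_right,
        adjoint_inner_right, ketRight_apply, ketLeft_apply]
  calc ⟪tmul e f, (tmap T (.id ℂ H) ∘L W ∘L ketLeft H (z : H)) y⟫_ℂ
      = ⟪tmul (Q s) f, W (tmul (z : H) y)⟫_ℂ := by
        rw [comp_apply, ← adjoint_inner_left, tmap_adjoint, tmap_tmul, adjoint_id, hQs]
        rfl
    _ = ⟪tmul e f, sliceMap W' (toConj (Q z))
          (conjFlip H H (W' (tmul (toConj k) (v : H)))) y⟫_ℂ := by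
        rw [h.inner_fst, inner_sliceMap, ketRight_adjoint_conjFlip, hs]

lemma forall_tmap_comp_ketLeft_mem_iff (h : IsManaged W Q W') (z : Q.domain)
    {N : Submodule ℂ (H →L[ℂ] H ⊗ₕ H)} (hN : IsClosed (N : Set (H →L[ℂ] H ⊗ₕ H))) :
    (∀ (v : Q.domain) (k : H), tmap ((ketRight H (Q v)).adjoint ∘L W.adjoint ∘L ketLeft H k)
      (.id ℂ H) ∘L W ∘L ketLeft H (z : H) ∈ N) ↔
    ∀ (p : Q.domain) (e : H), ketLeft H e ∘L leftSlice W (Q p) z ∈ N := by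
  let Φ : ConjSpace H ⊗ₕ H →L[ℂ] H →L[ℂ] H ⊗ₕ H := sliceMap W' (toConj (Q z))
  have hJW' : Function.Surjective fun ξ => conjFlip H H (W' ξ) :=
    Function.Surjective.comp (fun ξ => ⟨conjFlip H H ξ, conjFlip_conjFlip ξ⟩) h.surjective
  have h_dense : DenseRange ((↑) : Q.domain → H) := h.isSelfAdjoint.dense_domain.denseRange_val
  have h_conj : DenseRange fun x : H => toConj x := (toConjₗᵢ H).surjective.denseRange
  calc _ ↔ ∀ (k : H) (v : Q.domain), Φ (conjFlip H H (W' (tmul (toConj k) (v : H)))) ∈ N := by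
        rw [forall_comm]
        simp only [h.tmap_comp_ketLeft_eq, Φ]
    _ ↔ ∀ ξ, Φ (conjFlip H H (W' ξ)) ∈ N :=
        (forall_htensor_mem_iff_of_denseRange h_conj h_dense
          (Φ.comp ((conjFlip H H).toContinuousLinearMap.comp W')) hN).symm
    _ ↔ ∀ ξ, Φ ξ ∈ N := (hJW'.forall (p := fun ξ => Φ ξ ∈ N)).symm
    _ ↔ ∀ (p : Q.domain) (e : H), Φ (tmul (toConj (p : H)) e) ∈ N :=
        forall_htensor_mem_iff_of_denseRange
          (h_conj.comp h_dense (toConjₗᵢ H).continuous) denseRange_id Φ hN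
    _ ↔ _ := by simp only [Φ, sliceMap_tmul, h.leftSlice_eq]

lemma forall_mem_quantumAlgebra_iff (h : IsManaged W Q W') {F : Type*} [NormedAddCommGroup F]
    [NormedSpace ℂ F] (f : (H →L[ℂ] H) →L[ℂ] F) {N : Submodule ℂ F} (hN : IsClosed (N : Set F)) :
    (∀ a ∈ quantumAlgebra W, f a ∈ N) ↔ ∀ p z : Q.domain, f (leftSlice W (Q p) z) ∈ N :=
  calc (∀ a ∈ quantumAlgebra W, f a ∈ N)
      ↔ ∀ z x : H, f (leftSlice W x z) ∈ N :=
        (HilbertQG.forall_mem_quantumAlgebra_iff f hN).trans forall_comm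
    _ ↔ ∀ (z : H) (p : Q.domain), f (leftSlice W (Q p) z) ∈ N := forall_congr' fun z =>
        forall_mem_iff_of_denseRange (f := fun x => f (leftSlice W x z)) h.denseRange
          (by fun_prop) hN
    _ ↔ ∀ (p : Q.domain) (z : H), f (leftSlice W (Q p) z) ∈ N := forall_comm
    _ ↔ ∀ p z : Q.domain, f (leftSlice W (Q p) z) ∈ N := forall_congr' fun p =>
        forall_mem_iff_of_denseRange (f := fun z => f (leftSlice W (Q p) z))
          h.isSelfAdjoint.dense_domain.denseRange_val (by fun_prop) hN

lemma leftStable (h : IsManaged W Q W') (hW : IsMultiplicativeUnitary W) :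
    LeftStable W (columnModule H (quantumAlgebra W)) := by
  refine (leftStable_columnModule_iff hW.unitary_mem).2 fun N hN => ?_
  let T (v : Q.domain) (k : H) : H ⊗ₕ H →L[ℂ] H ⊗ₕ H :=
    tmap ((ketRight H (Q v)).adjoint ∘L W.adjoint ∘L ketLeft H k) (.id ℂ H)
  calc (∀ k, ∀ a ∈ quantumAlgebra W, W ∘L ketLeft H k ∘L a ∈ N)
      ↔ ∀ k z x : H, W ∘L ketLeft H k ∘L leftSlice W x z ∈ N := forall_congr' fun k =>
        (HilbertQG.forall_mem_quantumAlgebra_iff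
          (compL ℂ H _ _ W ∘L compL ℂ H _ _ (ketLeft H k)) hN).trans forall_comm
    _ ↔ ∀ (k z : H) (v : Q.domain), W ∘L ketLeft H k ∘L leftSlice W (Q v) z ∈ N :=
        forall₂_congr fun k z => forall_mem_iff_of_denseRange
          (f := fun x => W ∘L ketLeft H k ∘L leftSlice W x z) h.denseRange (by fun_prop) hN
    _ ↔ ∀ (v : Q.domain) (k z : H), W ∘L ketLeft H k ∘L leftSlice W (Q v) z ∈ N :=
        ⟨fun h v k z => h k z v, fun h k z v => h v k z⟩
    _ ↔ ∀ (v : Q.domain) (k z : H), T v k ∘L W ∘L ketLeft H z ∈ N := forall_congr' fun v =>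
        forall_comp_leftSlice_mem_iff hW.unitary_mem hW.pentagon (Q v) hN
    _ ↔ ∀ (v : Q.domain) (k : H) (z : Q.domain), T v k ∘L W ∘L ketLeft H (z : H) ∈ N :=
        forall₂_congr fun v k => forall_mem_iff_of_denseRange
          (f := fun z => T v k ∘L W ∘L ketLeft H z) h.isSelfAdjoint.dense_domain.denseRange_val
          (by fun_prop) hN
    _ ↔ ∀ (z v : Q.domain) (k : H), T v k ∘L W ∘L ketLeft H (z : H) ∈ N :=
        ⟨fun h z v k => h v k z, fun h v k z => h z v k⟩
    _ ↔ ∀ (z p : Q.domain) (e : H), ketLeft H e ∘L leftSlice W (Q p) z ∈ N :=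
        forall_congr' fun z => h.forall_tmap_comp_ketLeft_mem_iff z hN
    _ ↔ ∀ (e : H) (p z : Q.domain), ketLeft H e ∘L leftSlice W (Q p) z ∈ N :=
        ⟨fun h e p z => h z p e, fun h z p e => h e p z⟩
    _ ↔ ∀ e, ∀ a ∈ quantumAlgebra W, ketLeft H e ∘L a ∈ N := forall_congr' fun e =>
        (h.forall_mem_quantumAlgebra_iff (compL ℂ H _ _ (ketLeft H e)) hN).symm

end IsManaged

end ManagedAlgebra

section Algebra

variable {H K E F : Type*} [NormedAddCommGroup H] [InnerProductSpace ℂ H]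
  [NormedAddCommGroup K] [InnerProductSpace ℂ K]
  [NormedAddCommGroup E] [NormedSpace ℂ E] [NormedAddCommGroup F] [NormedSpace ℂ F]

lemma mem_of_forall_inner_self_smul_mem {T : E} {N : Submodule ℂ E}
    (hT : Subsingleton H → T = 0) (h : ∀ x : H, ⟪x, x⟫_ℂ • T ∈ N) : T ∈ N := by
  rcases subsingleton_or_nontrivial H with hH | _
  · rw [hT hH]
    exact N.zero_mem
  · obtain ⟨x, hx⟩ := exists_ne (0 : H)
    exact (N.smul_mem_iff (inner_self_ne_zero.2 hx)).1 (h x)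

lemma forall_ketRight_adjoint_mem_iff [CompleteSpace K] {V : K ⊗ₕ H →L[ℂ] K ⊗ₕ H}
    (hV : V ∈ unitary (K ⊗ₕ H →L[ℂ] K ⊗ₕ H)) (f : K →L[ℂ] H →L[ℂ] F)
    {N : Submodule ℂ (H →L[ℂ] F)} (hN : IsClosed (N : Set (H →L[ℂ] F))) :
    (∀ x k z, f ((ketRight K x).adjoint (V.adjoint (tmul k z))) ∈ N) ↔ ∀ k, f k ∈ N := by
  refine ⟨fun h k => ?_, fun h x k z => h _⟩
  refine mem_of_forall_inner_self_smul_mem (H := H) (fun _ => Subsingleton.elim _ _) fun x => ?_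
  have hx := (forall_htensor_mem_iff (f ∘L (ketRight K x).adjoint ∘L V.adjoint) hN).2 (h x)
    (V (tmul k x))
  have hVx : V.adjoint (V (tmul k x)) = tmul k x :=
    DFunLike.congr_fun (Unitary.star_mul_self_of_mem hV) _
  rwa [comp_apply, comp_apply, hVx, ketRight_adjoint_tmul, map_smul] at hx

variable [CompleteSpace H]

lemma ketLeft_adjoint_comp_mem {A : Submodule ℂ (H →L[ℂ] H)} (hA : IsClosed (A : Set (H →L[ℂ] H)))
    {T : H →L[ℂ] K ⊗ₕ H} (hT : T ∈ columnModule K A) (x : K) : (ketLeft H x).adjoint ∘L T ∈ A := by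
  refine (forall_mem_columnModule_iff (compL ℂ H _ _ (ketLeft H x).adjoint) hA).2
    (fun k a ha => ?_) T hT
  rw [compL_apply, ← comp_assoc, ketLeft_adjoint_comp_ketLeft, smul_comp,
    ContinuousLinearMap.id_comp]
  exact A.smul_mem _ ha

lemma LeftStable.leftSlice_comp_mem [CompleteSpace K] {T : K ⊗ₕ H →L[ℂ] K ⊗ₕ H}
    {A : Submodule ℂ (H →L[ℂ] H)} (h : LeftStable T (columnModule K A))
    (hA : IsClosed (A : Set (H →L[ℂ] H))) (x z : K) {a : H →L[ℂ] H} (ha : a ∈ A) :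
    leftSlice T x z ∘L a ∈ A :=
  ketLeft_adjoint_comp_mem hA ((h _).2 (ketLeft_comp_mem_columnModule z ha)) x

/-- Since `a` is a multiple of `(⟨x| ⊗ 1) T T* (|x⟩ ⊗ a)` and `T* (|x⟩ ⊗ a)` lies in `H ⊗ A`, the
products of slices of `T` with `A` span a dense subspace of `A`. -/
lemma LeftStable.forall_leftSlice_comp_mem_iff {T : H ⊗ₕ H →L[ℂ] H ⊗ₕ H}
    {A : Submodule ℂ (H →L[ℂ] H)} (h : LeftStable T (columnModule H A))
    (hT : T ∈ unitary (H ⊗ₕ H →L[ℂ] H ⊗ₕ H)) (hA : IsClosed (A : Set (H →L[ℂ] H))) {σ : ℂ →+* ℂ}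
    (f : (H →L[ℂ] H) →SL[σ] F) {N : Submodule ℂ F} (hN : IsClosed (N : Set F)) :
    (∀ x z, ∀ a ∈ A, f (leftSlice T x z ∘L a) ∈ N) ↔ ∀ a ∈ A, f a ∈ N := by
  refine ⟨fun hf a ha => ?_, fun hf x z a ha => hf _ (h.leftSlice_comp_mem hA x z ha)⟩
  suffices ∀ x : H, ⟪x, x⟫_ℂ • a ∈ N.comap f.toLinearMap from
    mem_of_forall_inner_self_smul_mem (N := N.comap f.toLinearMap)
      (fun _ => Subsingleton.elim _ _) this
  intro x
  have hx : ⟪x, x⟫_ℂ • a = (ketLeft H x).adjoint ∘L T ∘L T.adjoint ∘L ketLeft H x ∘L a := by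
    rw [comp_adjoint_comp_of_mem_unitary hT, ← comp_assoc, ketLeft_adjoint_comp_ketLeft, smul_comp,
      ContinuousLinearMap.id_comp]
  rw [hx]
  exact (forall_mem_columnModule_iff
    (f.comp (compL ℂ H _ _ (ketLeft H x).adjoint ∘L compL ℂ H _ _ T)) hN).2 (hf x) _
    ((h.adjoint hT _).2 (ketLeft_comp_mem_columnModule x ha))

variable (H) in
/-- The adjoint as a bounded semilinear operator. -/
def adjointL : (H →L[ℂ] H) →SL[starRingEnd ℂ] (H →L[ℂ] H) :=
  (adjoint (𝕜 := ℂ) (E := H) (F := H)).toContinuousLinearEquiv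

@[simp] lemma adjointL_apply (a : H →L[ℂ] H) : adjointL H a = a.adjoint := rfl

section QuantumAlgebra

variable {W : H ⊗ₕ H →L[ℂ] H ⊗ₕ H}

lemma isClosed_quantumAlgebra (W : H ⊗ₕ H →L[ℂ] H ⊗ₕ H) :
    IsClosed (quantumAlgebra W : Set (H →L[ℂ] H)) :=
  isClosed_closedSpan _

lemma LeftStable.adjoint_comp_mem_quantumAlgebra
    (h : LeftStable W (columnModule H (quantumAlgebra W))) (hW : W ∈ unitary _) {a b : H →L[ℂ] H}
    (ha : a ∈ quantumAlgebra W) (hb : b ∈ quantumAlgebra W) :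
    a.adjoint ∘L b ∈ quantumAlgebra W := by
  refine (forall_mem_quantumAlgebra_iff (((compL ℂ H H H).flip b).comp (adjointL H))
    (isClosed_quantumAlgebra W)).2 (fun x z => ?_) a ha
  change (leftSlice W x z).adjoint ∘L b ∈ quantumAlgebra W
  rw [leftSlice_adjoint]
  exact (h.adjoint hW).leftSlice_comp_mem (isClosed_quantumAlgebra W) z x hb

lemma LeftStable.adjoint_mem_quantumAlgebra
    (h : LeftStable W (columnModule H (quantumAlgebra W))) (hW : W ∈ unitary _) {a : H →L[ℂ] H}
    (ha : a ∈ quantumAlgebra W) : a.adjoint ∈ quantumAlgebra W := by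
  have hA := isClosed_quantumAlgebra W
  refine ((h.adjoint hW).forall_leftSlice_comp_mem_iff (Unitary.star_mem hW) hA (adjointL H) hA).1
    (fun x z b hb => ?_) a ha
  rw [adjointL_apply, adjoint_comp, leftSlice_adjoint, adjoint_adjoint]
  exact h.adjoint_comp_mem_quantumAlgebra hW hb (leftSlice_mem_quantumAlgebra W z x)

lemma LeftStable.of_leg23_mul_leg12 [CompleteSpace K] {V : K ⊗ₕ H →L[ℂ] K ⊗ₕ H}
    (h : LeftStable W (columnModule H (quantumAlgebra W))) (hW : W ∈ unitary _)
    (hV : V ∈ unitary (K ⊗ₕ H →L[ℂ] K ⊗ₕ H))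
    (hVW : leg23 K W * leg12 H V = leg12 H V * leg13 H V * leg23 K W) :
    LeftStable V (columnModule K (quantumAlgebra W)) := by
  refine (leftStable_columnModule_iff hV).2 fun N hN => ?_
  let A := quantumAlgebra W
  let T (x : H) (k : K) : H →L[ℂ] K := (ketRight K x).adjoint ∘L V.adjoint ∘L ketLeft H k
  calc (∀ k, ∀ a ∈ A, V ∘L ketLeft H k ∘L a ∈ N)
      ↔ ∀ k x z, ∀ b ∈ A, V ∘L ketLeft H k ∘L leftSlice W x z ∘L b ∈ N := forall_congr' fun k =>
        (h.forall_leftSlice_comp_mem_iff hW (isClosed_quantumAlgebra W)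
          (compL ℂ H _ _ V ∘L compL ℂ H _ _ (ketLeft H k)) hN).symm
    _ ↔ ∀ b ∈ A, ∀ x k z, V ∘L ketLeft H k ∘L leftSlice W x z ∘L b ∈ N :=
        ⟨fun h b hb x k z => h k x z b hb, fun h k x z b hb => h b hb x k z⟩
    _ ↔ ∀ b ∈ A, ∀ x k z, tmap (T x k) (.id ℂ H) ∘L W ∘L ketLeft H z ∘L b ∈ N :=
        forall₃_congr fun b _ x => by
          simpa only [Submodule.mem_comap, coe_coe, flip_apply, compL_apply, comp_assoc] using
            forall_comp_leftSlice_mem_iff hV hVW x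
              (N := N.comap ((compL ℂ H H (K ⊗ₕ H)).flip b).toLinearMap)
              (hN.preimage ((compL ℂ H H (K ⊗ₕ H)).flip b).continuous)
    _ ↔ ∀ x k z, ∀ b ∈ A, tmap (T x k) (.id ℂ H) ∘L W ∘L ketLeft H z ∘L b ∈ N :=
        ⟨fun h x k z b hb => h b hb x k z, fun h b hb x k z => h x k z b hb⟩
    _ ↔ ∀ x k z, ∀ b ∈ A, tmap (T x k) (.id ℂ H) ∘L ketLeft H z ∘L b ∈ N :=
        forall₂_congr fun x k => (leftStable_columnModule_iff hW).1 h
          (N.comap (compL ℂ H _ _ (tmap (T x k) (.id ℂ H))).toLinearMap)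
          (hN.preimage (compL ℂ H _ _ (tmap (T x k) (.id ℂ H))).continuous)
    _ ↔ ∀ b ∈ A, ∀ x k z, ketLeft H (T x k z) ∘L b ∈ N := by
        simp only [← comp_assoc, tmap_comp_ketLeft, ContinuousLinearMap.comp_id]
        exact ⟨fun h b hb x k z => h x k z b hb, fun h x k z b hb => h b hb x k z⟩
    _ ↔ ∀ b ∈ A, ∀ k, ketLeft H k ∘L b ∈ N := forall₂_congr fun b _ =>
        forall_ketRight_adjoint_mem_iff hV ((compL ℂ H H (K ⊗ₕ H)).flip b ∘L ketLeftL K H) hN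
    _ ↔ ∀ k, ∀ b ∈ A, ketLeft H k ∘L b ∈ N :=
        ⟨fun h k b hb => h b hb k, fun h b hb k => h k b hb⟩

end QuantumAlgebra

end Algebra

section Dual

variable {H : Type*} [NormedAddCommGroup H] [InnerProductSpace ℂ H]
  {W : H ⊗ₕ H →L[ℂ] H ⊗ₕ H}

variable (H) in
/-- The flip `x ⊗ y ⊗ z ↦ z ⊗ y ⊗ x` of the outer legs. -/
def flip13 : (H ⊗ₕ H) ⊗ₕ H →L[ℂ] (H ⊗ₕ H) ⊗ₕ H :=
  leg12 H (flip H H) * leg23 H (flip H H) * leg12 H (flip H H)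

@[simp] lemma flip13_tmul (x y z : H) : flip13 H (tmul (tmul x y) z) = tmul (tmul z y) x := by
  simp [flip13]

lemma flip13_mul_flip13_mul (T : (H ⊗ₕ H) ⊗ₕ H →L[ℂ] (H ⊗ₕ H) ⊗ₕ H) :
    flip13 H * (flip13 H * T) = T := by
  have h : flip13 H * flip13 H = 1 := clm_ext₃ fun x y z => by simp
  rw [← mul_assoc, h, one_mul]

lemma flip13_tmul_right (ξ : H ⊗ₕ H) (z : H) :
    flip13 H (tmul ξ z) = tmap (ketLeft H z) (.id ℂ H) (flip H H ξ) :=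
  DFunLike.congr_fun (f := flip13 H ∘L ketRight (H ⊗ₕ H) z)
    (g := tmap (ketLeft H z) (.id ℂ H) ∘L (flip H H : H ⊗ₕ H →L[ℂ] H ⊗ₕ H))
    (clm_ext fun x y => by simp) ξ

lemma flip13_tmap_ketLeft (ξ : H ⊗ₕ H) (x : H) :
    flip13 H (tmap (ketLeft H x) (.id ℂ H) ξ) = tmul (flip H H ξ) x :=
  DFunLike.congr_fun (f := flip13 H ∘L tmap (ketLeft H x) (.id ℂ H))
    (g := ketRight (H ⊗ₕ H) x ∘L (flip H H : H ⊗ₕ H →L[ℂ] H ⊗ₕ H))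
    (clm_ext fun y z => by simp) ξ

lemma flip13_tmap_ketRight (ξ : H ⊗ₕ H) (y : H) :
    flip13 H (tmap (ketRight H y) (.id ℂ H) ξ) =
      tmap (ketRight H y) (.id ℂ H) (flip H H ξ) :=
  DFunLike.congr_fun (f := flip13 H ∘L tmap (ketRight H y) (.id ℂ H))
    (g := tmap (ketRight H y) (.id ℂ H) ∘L (flip H H : H ⊗ₕ H →L[ℂ] H ⊗ₕ H))
    (clm_ext fun x z => by simp) ξ

lemma flip_mem_unitary : (flip H H : H ⊗ₕ H →L[ℂ] H ⊗ₕ H) ∈ unitary _ := by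
  have h : (flip H H : H ⊗ₕ H →L[ℂ] H ⊗ₕ H) * flip H H = 1 := clm_ext fun x y => by simp
  rw [Unitary.mem_iff, star_eq_adjoint, flip_adjoint]
  exact ⟨h, h⟩

lemma dualUnitary_mem_unitary (hW : W ∈ unitary _) :
    dualUnitary W ∈ unitary (H ⊗ₕ H →L[ℂ] H ⊗ₕ H) :=
  mul_mem flip_mem_unitary (mul_mem (Unitary.star_mem hW) flip_mem_unitary)

variable [CompleteSpace H]

lemma leg12_dualUnitary :
    leg12 H (dualUnitary W) = flip13 H * (leg23 H W).adjoint * flip13 H := by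
  rw [leg23_adjoint]
  exact clm_ext₃ fun x y z => by simp [dualUnitary, flip13_tmap_ketLeft]

lemma leg23_dualUnitary :
    leg23 H (dualUnitary W) = flip13 H * (leg12 H W).adjoint * flip13 H := by
  rw [leg12_adjoint]
  exact clm_ext₃ fun x y z => by simp [dualUnitary, flip13_tmul_right]

lemma leg13_dualUnitary :
    leg13 H (dualUnitary W) = flip13 H * (leg13 H W).adjoint * flip13 H := by
  rw [leg13_adjoint]
  exact clm_ext₃ fun x y z => by simp [dualUnitary, flip13_tmap_ketRight]

lemma IsMultiplicativeUnitary.dual (hW : IsMultiplicativeUnitary W) :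
    IsMultiplicativeUnitary (dualUnitary W) where
  unitary_mem := dualUnitary_mem_unitary hW.unitary_mem
  pentagon := by
    have h_star := congrArg adjoint hW.pentagon
    simp only [← star_eq_adjoint, star_mul, mul_assoc] at h_star
    simp only [leg12_dualUnitary, leg23_dualUnitary, leg13_dualUnitary, ← star_eq_adjoint,
      mul_assoc, flip13_mul_flip13_mul]
    rw [← mul_assoc (star (leg12 H W)), h_star]
    simp only [mul_assoc]

lemma leftSlice_dualUnitary (x z : H) : leftSlice (dualUnitary W) x z =
    ((ketRight H z).adjoint ∘L W ∘L ketRight H x).adjoint := by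
  simp only [leftSlice, dualUnitary, adjoint_comp, adjoint_adjoint, ← flip_comp_ketLeft,
    flip_adjoint, comp_assoc]

lemma LeftStable.dualQuantumAlgebra_eq
    (h : LeftStable (dualUnitary W) (columnModule H (quantumAlgebra (dualUnitary W))))
    (hW : W ∈ unitary _) : dualQuantumAlgebra W = quantumAlgebra (dualUnitary W) := by
  have h_adjoint {a : H →L[ℂ] H} (ha : a ∈ quantumAlgebra (dualUnitary W)) :=
    h.adjoint_mem_quantumAlgebra (dualUnitary_mem_unitary hW) ha
  have h_slice (x z : H) : (ketRight H x).adjoint ∘L W ∘L ketRight H z =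
      (leftSlice (dualUnitary W) z x).adjoint := by
    rw [leftSlice_dualUnitary, adjoint_adjoint]
  refine le_antisymm ((closedSpan_le_iff (isClosed_quantumAlgebra _)).2 fun p => ?_) fun a ha => ?_
  · rw [h_slice]
    exact h_adjoint (leftSlice_mem_quantumAlgebra _ _ _)
  · have h_star : ∀ b ∈ quantumAlgebra (dualUnitary W), adjointL H b ∈ dualQuantumAlgebra W :=
      (forall_mem_quantumAlgebra_iff (adjointL H) (isClosed_closedSpan _)).2 fun x z => by
        rw [adjointL_apply, ← h_slice]
        exact mem_closedSpan _ (z, x)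
    simpa only [adjointL_apply, adjoint_adjoint] using h_star _ (h_adjoint ha)

end Dual

section StableProducts

variable {E F : Type*} [NormedAddCommGroup E] [NormedSpace ℂ E]
  [NormedAddCommGroup F] [InnerProductSpace ℂ F]
  {S T : F →L[ℂ] F} {M : Submodule ℂ (E →L[ℂ] F)}

lemma LeftStable.mul (hS : LeftStable S M) (hT : LeftStable T M) : LeftStable (S * T) M :=
  fun R => (hS _).trans (hT R)

variable [CompleteSpace F]

lemma LeftStable.of_mul (hST : LeftStable (S * T) M) (hT : LeftStable T M)
    (hT_mem : T ∈ unitary (F →L[ℂ] F)) : LeftStable S M := fun R => by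
  have h := hST (T.adjoint ∘L R)
  rwa [mul_def, comp_assoc, comp_adjoint_comp_of_mem_unitary hT_mem, hT.adjoint hT_mem] at h

lemma mem_multipliers_of_leftStable {M : Submodule ℂ (F →L[ℂ] F)} (h : LeftStable T M)
    (hT : T ∈ unitary (F →L[ℂ] F)) (hM : ∀ S ∈ M, S.adjoint ∈ M) : T ∈ multipliers M := by
  refine fun S hS => ⟨(h S).2 hS, ?_⟩
  have h_adjoint := hM _ ((h.adjoint hT _).2 (hM S hS))
  rwa [adjoint_comp, adjoint_adjoint, adjoint_adjoint] at h_adjoint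

end StableProducts

section SpatialTensor

variable {H K : Type*} [NormedAddCommGroup H] [InnerProductSpace ℂ H]
  [NormedAddCommGroup K] [InnerProductSpace ℂ K]
  {A : Submodule ℂ (K →L[ℂ] K)} {B : Submodule ℂ (H →L[ℂ] H)}

/-- The closed linear span of the operators `b ⊗ |h⟩ ⊗ a` for `b ∈ B`, `h ∈ H` and `a ∈ A`: the
Hilbert module `B ⊗ H ⊗ A` over `B ⊗ A`. -/
def middleModule (B : Submodule ℂ (H →L[ℂ] H)) (A : Submodule ℂ (K →L[ℂ] K)) :
    Submodule ℂ (H ⊗ₕ K →L[ℂ] (H ⊗ₕ H) ⊗ₕ K) :=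
  closedSpan fun p : B × H × A => tmap (ketRight H p.2.1 ∘L (p.1 : H →L[ℂ] H)) (p.2.2 : K →L[ℂ] K)

lemma leftStable_middleModule_iff {T : (H ⊗ₕ H) ⊗ₕ K →L[ℂ] (H ⊗ₕ H) ⊗ₕ K} (hT : T ∈ unitary _) :
    LeftStable T (middleModule B A) ↔ ∀ N : Submodule ℂ (H ⊗ₕ K →L[ℂ] (H ⊗ₕ H) ⊗ₕ K),
      IsClosed (N : Set (H ⊗ₕ K →L[ℂ] (H ⊗ₕ H) ⊗ₕ K)) →
      ((∀ b ∈ B, ∀ h, ∀ a ∈ A, T ∘L tmap (ketRight H h ∘L b) a ∈ N) ↔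
        ∀ b ∈ B, ∀ h, ∀ a ∈ A, tmap (ketRight H h ∘L b) a ∈ N) := by
  rw [middleModule, leftStable_closedSpan_iff hT]
  simp only [Prod.forall, Subtype.forall]

lemma leftStable_spatialTensor_iff {T : H ⊗ₕ K →L[ℂ] H ⊗ₕ K} (hT : T ∈ unitary _) :
    LeftStable T (spatialTensor B A) ↔ ∀ N : Submodule ℂ (H ⊗ₕ K →L[ℂ] H ⊗ₕ K),
      IsClosed (N : Set (H ⊗ₕ K →L[ℂ] H ⊗ₕ K)) →
      ((∀ b ∈ B, ∀ a ∈ A, T ∘L tmap b a ∈ N) ↔ ∀ b ∈ B, ∀ a ∈ A, tmap b a ∈ N) := by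
  refine (leftStable_closedSpan_iff hT).trans ?_
  simp only [Prod.forall, Subtype.forall]

lemma tmap_mem_spatialTensor {b : H →L[ℂ] H} {a : K →L[ℂ] K} (hb : b ∈ B) (ha : a ∈ A) :
    tmap b a ∈ spatialTensor B A :=
  mem_closedSpan (fun p : B × A => tmap (p.1 : H →L[ℂ] H) (p.2 : K →L[ℂ] K)) (⟨b, hb⟩, ⟨a, ha⟩)

variable [CompleteSpace H]

lemma adjoint_mem_spatialTensor [CompleteSpace K] (hB : ∀ b ∈ B, b.adjoint ∈ B)
    (hA : ∀ a ∈ A, a.adjoint ∈ A) :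
    ∀ S ∈ spatialTensor B A, S.adjoint ∈ spatialTensor B A := by
  refine (forall_mem_closedSpan_iff (adjointL (H ⊗ₕ K)) (N := spatialTensor B A)
    (g := fun p : B × A => tmap (p.1 : H →L[ℂ] H) (p.2 : K →L[ℂ] K))
    (isClosed_closedSpan _)).2 fun p => ?_
  rw [adjointL_apply, tmap_adjoint]
  exact tmap_mem_spatialTensor (hB _ p.1.2) (hA _ p.2.2)

lemma LeftStable.leg12_adjoint [CompleteSpace K] {T : H ⊗ₕ H →L[ℂ] H ⊗ₕ H} (hT : T ∈ unitary _)
    (h : LeftStable (dualUnitary T) (columnModule H B)) :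
    LeftStable (leg12 K T.adjoint) (middleModule B A) := by
  refine (leftStable_middleModule_iff (leg12_mem_unitary (Unitary.star_mem hT))).2 fun N hN => ?_
  let f (a : K →L[ℂ] K) : (H →L[ℂ] H ⊗ₕ H) →L[ℂ] H ⊗ₕ K →L[ℂ] (H ⊗ₕ H) ⊗ₕ K :=
    tmapL.flip a ∘L compL ℂ H _ _ (flip H H : H ⊗ₕ H →L[ℂ] H ⊗ₕ H)
  have f_ket (a : K →L[ℂ] K) (h : H) (b : H →L[ℂ] H) :
      f a (ketLeft H h ∘L b) = tmap (ketRight H h ∘L b) a := by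
    rw [← flip_comp_ketLeft, comp_assoc]
    rfl
  have f_dualUnitary_ket (a : K →L[ℂ] K) (h : H) (b : H →L[ℂ] H) :
      f a (dualUnitary T ∘L ketLeft H h ∘L b) =
        leg12 K T.adjoint ∘L tmap (ketRight H h ∘L b) a :=
    clm_ext fun x y => by simp [f, dualUnitary]
  have h_stable (a : K →L[ℂ] K) := (leftStable_columnModule_iff (dualUnitary_mem_unitary hT)).1 h
    (N.comap (f a).toLinearMap) (hN.preimage (f a).continuous)
  simp only [Submodule.mem_comap, coe_coe, f_ket, f_dualUnitary_ket] at h_stable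
  exact ⟨fun hb b hbB h a ha => (h_stable a).1 (fun h b hbB => hb b hbB h a ha) h b hbB,
    fun hb b hbB h a ha => (h_stable a).2 (fun h b hbB => hb b hbB h a ha) h b hbB⟩

lemma LeftStable.leg23 {T : H ⊗ₕ K →L[ℂ] H ⊗ₕ K} (hT : T ∈ unitary _)
    (h : LeftStable T (columnModule H A)) : LeftStable (leg23 H T) (middleModule B A) := by
  refine (leftStable_middleModule_iff (leg23_mem_unitary hT)).2 fun N hN => ?_
  let f (b : H →L[ℂ] H) : (K →L[ℂ] H ⊗ₕ K) →L[ℂ] H ⊗ₕ K →L[ℂ] (H ⊗ₕ H) ⊗ₕ K :=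
    compL ℂ (H ⊗ₕ K) _ _ ((assoc H H K).symm : H ⊗ₕ (H ⊗ₕ K) →L[ℂ] (H ⊗ₕ H) ⊗ₕ K) ∘L tmapL b
  have f_ket (b : H →L[ℂ] H) (h : H) (a : K →L[ℂ] K) :
      f b (ketLeft K h ∘L a) = tmap (ketRight H h ∘L b) a :=
    clm_ext fun x y => by simp [f]
  have f_comp_ket (b : H →L[ℂ] H) (h : H) (a : K →L[ℂ] K) :
      f b (T ∘L ketLeft K h ∘L a) = HilbertQG.leg23 H T ∘L tmap (ketRight H h ∘L b) a :=
    clm_ext fun x y => by simp [f, assoc_symm_tmul_left]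
  refine forall₂_congr fun b _ => ?_
  simpa only [Submodule.mem_comap, coe_coe, f_ket, f_comp_ket] using
    (leftStable_columnModule_iff hT).1 h (N.comap (f b).toLinearMap)
      (hN.preimage (f b).continuous)

lemma LeftStable.of_leg13 {V : H ⊗ₕ K →L[ℂ] H ⊗ₕ K} (hV : V ∈ unitary _)
    (h : LeftStable (leg13 H V) (middleModule B A)) : LeftStable V (spatialTensor B A) := by
  refine (leftStable_spatialTensor_iff hV).2 fun N hN => ?_
  let slice (x : H) : (H ⊗ₕ H) ⊗ₕ K →L[ℂ] H ⊗ₕ K := tmap (ketRight H x).adjoint (.id ℂ K)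
  have h_slice (x h : H) (b : H →L[ℂ] H) (a : K →L[ℂ] K) :
      slice x ∘L tmap (ketRight H h ∘L b) a = ⟪x, h⟫_ℂ • tmap b a :=
    clm_ext fun p q => by simp [slice, smul_tmul]
  have h_slice_leg13 (x h : H) (b : H →L[ℂ] H) (a : K →L[ℂ] K) :
      slice x ∘L leg13 H V ∘L tmap (ketRight H h ∘L b) a = ⟪x, h⟫_ℂ • V ∘L tmap b a := by
    rw [← comp_assoc, tmap_ketRight_adjoint_comp_leg13, comp_assoc, h_slice, comp_smul]
  have smul_mem_iff (R : (H →L[ℂ] H) → (K →L[ℂ] K) → H ⊗ₕ K →L[ℂ] H ⊗ₕ K) :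
      (∀ x : H, ∀ b ∈ B, ∀ h : H, ∀ a ∈ A, ⟪x, h⟫_ℂ • R b a ∈ N) ↔ ∀ b ∈ B, ∀ a ∈ A, R b a ∈ N :=
    ⟨fun hR b hb a ha => mem_of_forall_inner_self_smul_mem
      (fun _ => clm_ext fun p q => by
        rw [Subsingleton.elim p 0, ← ketRight_apply, map_zero, map_zero, zero_apply])
      fun x => hR x b hb x a ha,
      fun hR x b hb h a ha => N.smul_mem _ (hR b hb a ha)⟩
  calc (∀ b ∈ B, ∀ a ∈ A, V ∘L tmap b a ∈ N)
      ↔ ∀ x : H, ∀ b ∈ B, ∀ h : H, ∀ a ∈ A,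
          slice x ∘L leg13 H V ∘L tmap (ketRight H h ∘L b) a ∈ N := by
        simp only [h_slice_leg13, smul_mem_iff]
    _ ↔ ∀ x : H, ∀ b ∈ B, ∀ h : H, ∀ a ∈ A, slice x ∘L tmap (ketRight H h ∘L b) a ∈ N :=
        forall_congr' fun x => (leftStable_middleModule_iff (leg13_mem_unitary hV)).1 h
          (N.comap (compL ℂ (H ⊗ₕ K) _ _ (slice x)).toLinearMap)
          (hN.preimage (compL ℂ (H ⊗ₕ K) _ _ (slice x)).continuous)
    _ ↔ ∀ b ∈ B, ∀ a ∈ A, tmap b a ∈ N := by simp only [h_slice, smul_mem_iff]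

end SpatialTensor

section Bicharacter

variable {H K : Type*} [NormedAddCommGroup H] [InnerProductSpace ℂ H]
  [NormedAddCommGroup K] [InnerProductSpace ℂ K]
  {X : H ⊗ₕ H →L[ℂ] H ⊗ₕ H} {Y : K ⊗ₕ K →L[ℂ] K ⊗ₕ K} {V : H ⊗ₕ K →L[ℂ] H ⊗ₕ K}
  {A : Submodule ℂ (K →L[ℂ] K)} {B : Submodule ℂ (H →L[ℂ] H)}

lemma leg12_adjoint_mul_leg23_mul_leg12 [CompleteSpace K] (hX : X ∈ unitary _)
    (hVX : leg23 H V * leg12 K X = leg12 K X * leg13 H V * leg23 H V) :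
    (leg12 K X).adjoint * leg23 H V * leg12 K X = leg13 H V * leg23 H V := by
  rw [mul_assoc, hVX, mul_assoc]
  exact adjoint_comp_comp_of_mem_unitary (leg12_mem_unitary hX) _

lemma dualComulFst_eq [CompleteSpace K] (hX : X ∈ unitary _)
    (hVX : leg23 H V * leg12 K X = leg12 K X * leg13 H V * leg23 H V) :
    dualComulFst X V = leg23 H V * leg13 H V := by
  rw [dualComulFst, leg12_adjoint_mul_leg23_mul_leg12 hX hVX, ← mul_assoc, leg12_flip_mul_leg13,
    mul_assoc, mul_assoc]
  congr 1
  rw [← leg12_flip_mul_leg13, ← mul_assoc, leg12_flip_mul_leg12_flip, one_mul]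

lemma comulSnd_eq [CompleteSpace H] (hY : Y ∈ unitary _)
    (hVY : leg23 H Y * leg12 K V = leg12 K V * leg13 K V * leg23 H Y) :
    comulSnd Y V = leg12 K V * leg13 K V := by
  rw [comulSnd, hVY, mul_assoc, ← star_eq_adjoint,
    Unitary.mul_star_self_of_mem (leg23_mem_unitary hY), mul_one]

variable [CompleteSpace H] [CompleteSpace K]

lemma leftStable_spatialTensor_of_leg23_mul_leg12 (hX : X ∈ unitary _) (hV : V ∈ unitary _)
    (hB : LeftStable (dualUnitary X) (columnModule H B)) (hA : LeftStable V (columnModule H A))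
    (hVX : leg23 H V * leg12 K X = leg12 K X * leg13 H V * leg23 H V) :
    LeftStable V (spatialTensor B A) := by
  have h23 : LeftStable (leg23 H V) (middleModule B A) := hA.leg23 hV
  have h12_adjoint : LeftStable (leg12 K X.adjoint) (middleModule B A) := hB.leg12_adjoint hX
  have h12 : LeftStable (leg12 K X) (middleModule B A) := by
    have h := h12_adjoint.adjoint (leg12_mem_unitary (Unitary.star_mem hX))
    rwa [HilbertQG.leg12_adjoint, adjoint_adjoint] at h
  have h13_mul : LeftStable (leg13 H V * leg23 H V) (middleModule B A) := by
    rw [← leg12_adjoint_mul_leg23_mul_leg12 hX hVX, HilbertQG.leg12_adjoint]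
    exact (h12_adjoint.mul h23).mul h12
  exact (h13_mul.of_mul h23 (leg23_mem_unitary hV)).of_leg13 hV

lemma IsManageable.leftStable (h : IsManageable Y) (hY : IsMultiplicativeUnitary Y) :
    LeftStable Y (columnModule K (quantumAlgebra Y)) := by
  obtain ⟨Q, Y', hQ⟩ := h.exists_isManaged
  exact hQ.leftStable hY

lemma IsManageable.leftStable_dual (h : IsManageable Y) (hY : IsMultiplicativeUnitary Y) :
    LeftStable (dualUnitary Y) (columnModule K (quantumAlgebra (dualUnitary Y))) := by
  obtain ⟨Q, Y', hQ⟩ := h.exists_isManaged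
  exact hQ.dual.leftStable hY.dual

lemma IsManageable.isBicharacter (hX : IsManageable X) (hXu : IsMultiplicativeUnitary X)
    (hY : IsManageable Y) (hYu : IsMultiplicativeUnitary Y) (hV : V ∈ unitary _)
    (hVX : leg23 H V * leg12 K X = leg12 K X * leg13 H V * leg23 H V)
    (hVY : leg23 H Y * leg12 K V = leg12 K V * leg13 K V * leg23 H Y) :
    IsBicharacter X Y V where
  unitary_mem := hV
  mem_multipliers := by
    have h_alg := hY.leftStable hYu
    have h_dual := hX.leftStable_dual hXu
    have hV_alg := h_alg.of_leg23_mul_leg12 hYu.unitary_mem hV hVY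
    rw [h_dual.dualQuantumAlgebra_eq hXu.unitary_mem]
    exact mem_multipliers_of_leftStable
      (leftStable_spatialTensor_of_leg23_mul_leg12 hXu.unitary_mem hV h_dual hV_alg hVX) hV
      (adjoint_mem_spatialTensor
        (fun _ => h_dual.adjoint_mem_quantumAlgebra hXu.dual.unitary_mem)
        (fun _ => h_alg.adjoint_mem_quantumAlgebra hYu.unitary_mem))
  dualComul_eq := dualComulFst_eq hXu.unitary_mem hVX
  comul_eq := comulSnd_eq hYu.unitary_mem hVY

end Bicharacter

end HilbertQG

end

theorem mainTheorem5 (C : HilbertTensorCategory.{u, v}) {H H' : Type u}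
    [NormedAddCommGroup H] [InnerProductSpace ℂ H] [CompleteSpace H]
    [NormedAddCommGroup H'] [InnerProductSpace ℂ H'] [CompleteSpace H']
    (ρ : C.Obj H) (A : NaturalRightAbsorber C ρ) (ρ' : C.Obj H') (A' : NaturalRightAbsorber C ρ')
    (U : H ⊗ₕ H →L[ℂ] H ⊗ₕ H) (hU : U = A.U ρ)
    (U' : H' ⊗ₕ H' →L[ℂ] H' ⊗ₕ H') (hU' : U' = A'.U ρ')
    (V : H' ⊗ₕ H →L[ℂ] H' ⊗ₕ H) (hV : V = A.U ρ')
    (W : H ⊗ₕ H' →L[ℂ] H ⊗ₕ H') (hW : W = A'.U ρ) :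
    (IsMultiplicativeUnitary U ∧ IsMultiplicativeUnitary U') ∧
    (leg23 H' U * leg12 H V = leg12 H V * leg13 H V * leg23 H' U ∧
      leg23 H U' * leg12 H' W = leg12 H' W * leg13 H' W * leg23 H U' ∧
      leg23 H' V * leg12 H U' = leg12 H U' * leg13 H' V * leg23 H' V ∧
      leg23 H W * leg12 H' U = leg12 H' U * leg13 H W * leg23 H W ∧
      leg23 H V * leg12 H W = leg12 H W * leg13 H' U * leg23 H V ∧
      leg23 H' W * leg12 H' V = leg12 H' V * leg13 H U' * leg23 H' W) ∧
    (IsManageable U → IsManageable U' → AreInverseMorphisms U' U V W) := by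
  subst hU hU' hV hW
  have hm : IsMultiplicativeUnitary (A.U ρ) := A.isMultiplicativeUnitary
  have hm' : IsMultiplicativeUnitary (A'.U ρ') := A'.isMultiplicativeUnitary
  have comul_V := A.leg23_mul_leg12 A ρ'
  have comul_W := A'.leg23_mul_leg12 A' ρ
  have dualComul_V := A'.leg23_mul_leg12 A ρ'
  have dualComul_W := A.leg23_mul_leg12 A' ρ
  have comp_W_V := A'.leg23_mul_leg12 A ρ
  have comp_V_W := A.leg23_mul_leg12 A' ρ'
  refine ⟨⟨hm, hm'⟩, ⟨comul_V, comul_W, dualComul_V, dualComul_W, comp_W_V, comp_V_W⟩,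
    fun h h' => ?_⟩
  have hV := h'.isBicharacter hm' h hm (A.unitary_mem ρ') dualComul_V comul_V
  have hW := h.isBicharacter hm h' hm' (A'.unitary_mem ρ) dualComul_W comul_W
  have hU := h.isBicharacter hm h hm hm.unitary_mem hm.pentagon hm.pentagon
  have hU' := h'.isBicharacter hm' h' hm' hm'.unitary_mem hm'.pentagon hm'.pentagon
  exact ⟨⟨hV, hW, hU', comp_V_W⟩, ⟨hW, hV, hU, comp_W_V⟩⟩
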